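/- A \emph{stationary Bratteli diagram} $B$ has one vertex $v_0$ at level $0$, the same finite nonempty vertex set at every level $n\ge 1$, finitely many edges between consecutive levels (from level $n$ to level $n+1$), the numbers of edges between given vertices of levels $n$ and $n+1$ being independent of $n\ge 1$, such that every vertex emits at least one edge and every vertex other than $v_0$ receives at least one. Let $X_B$ be the space of infinite paths starting at $v_0$, with the topology generated by the cylinder sets; it is assumed to be a Cantor set. Let $\mathcal R$ be the tail equivalence relation on $X_B$: two paths are equivalent if they agree from some level on. The diagram is \emph{simple} if every $\mathcal R$-class is dense; a \emph{minimal component} is a minimal nonempty closed $\mathcal R$-saturated subset of $X_B$. A Borel probability measure on $X_B$ is \emph{$\mathcal R$-invariant} if cylinder sets of finite paths from $v_0$ to the same vertex have equal measure, and \emph{ergodic} if every $\mathcal R$-saturated Borel set has measure $0$ or $1$. A measure $\mu$ on a space $X$ is \emph{good} if it is full (nonempty clopen sets have positive measure), non-atomic, and for all clopen $U,V\subset X$ with $\mu(U)<\mu(V)$ there is a clopen $W\subset V$ with $\mu(W)=\mu(U)$. Measures $\mu$ on $X$ and $\nu$ on $Y$ are \emph{homeomorphic} if $h_*\mu=\nu$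 for some homeomorphism $h:X\to Y$. Relations $(X_B,\mathcal R)$ and $(X_{B'},\mathcal R')$ are \emph{topologically orbit equivalent} if there is a homeomorphism $h:X_B\to X_{B'}$ with $x\,\mathcal R\,y\iff h(x)\,\mathcal R'\,h(y)$. \textbf{Theorem.} Let $B$ be a stationary (not necessarily simple) Bratteli diagram and let $\mu$ be an ergodic $\mathcal R$-invariant Borel probability measure on $X_B$ which is good when regarded as a measure on its topological support. Then there are stationary Bratteli diagrams $B_i$ ($i=0,1,2,\dots$), with tail equivalence relations $\mathcal R_i$ all of whose classes are infinite, and ergodic $\mathcal R_i$-invariant Borel probability measures $\mu_i$ on $X_{B_i}$, such that (a) for every $i\ge 0$ the measure $\mu_i$ is good on $X_{B_i}$ (in particular full) and is homeomorphic to $\mu$ (regarded as a measure on its support); (b) for all $i,j\ge 0$, $(X_{B_i},\mathcal R_i)$ and $(X_{B_j},\mathcal R_j)$ are topologically orbit equivalent if and only if $i=j$; (c) $B_0$ is simple, and for every $i\ge 1$ the diagram $B_i$ has exactly $i$ minimal components. -/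

import Mathlib

open MeasureTheory Topology

/-! ### Good measures on zero-dimensional spaces -/

/-- The measure `μ` regarded as a measure on its topological support (the complement of the
largest open null set), with the subspace topology and the induced Borel structure. -/
noncomputable def suppMeasure {X : Type*} [TopologicalSpace X] [MeasurableSpace X]
    (μ : Measure X) : Measure μ.support :=
  μ.comap Subtype.val

/-- A measure is full if every nonempty clopen set has positive measure. -/
def IsFull {X : Type*} [TopologicalSpace X] [MeasurableSpace X] (μ : Measure X) : Prop :=
  ∀ V : Set X, IsClopen V → V.Nonempty → 0 < μ V

/-- A clopen set `V` is good for `μ` if every value `μ U < μ V`, `U` clopen, is attained on a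
clopen subset of `V`. -/
def IsGoodClopen {X : Type*} [TopologicalSpace X] [MeasurableSpace X] (μ : Measure X)
    (V : Set X) : Prop :=
  ∀ U : Set X, IsClopen U → μ U < μ V → ∃ W : Set X, IsClopen W ∧ W ⊆ V ∧ μ W = μ U

/-- A measure is good if it is full, non-atomic, and every clopen set is good for it. -/
structure IsGoodMeasure {X : Type*} [TopologicalSpace X] [MeasurableSpace X]
    (μ : Measure X) : Prop where
  full : IsFull μ
  noAtoms : ∀ x : X, μ {x} = 0
  good : ∀ V : Set X, IsClopen V → IsGoodClopen μ V

/-- Two measures are homeomorphic if some homeomorphism carries one to the other. -/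
def HomeomorphicMeasures {X Y : Type*} [TopologicalSpace X] [MeasurableSpace X]
    [TopologicalSpace Y] [MeasurableSpace Y] (μ : Measure X) (ν : Measure Y) : Prop :=
  ∃ h : X ≃ₜ Y, μ.map h = ν

/-! ### Stationary Bratteli diagrams -/

/-- A stationary Bratteli diagram. Level `0` is a single vertex; every level `n ≥ 1` has the
vertices `Fin size`. There are `top v` edges from level `0` to the vertex `v` of level `1`, and
`inc v w` edges from the vertex `w` of level `n` to the vertex `v` of level `n + 1` for every
`n ≥ 1`. Every vertex emits an edge, and every vertex except the one of level `0` receives one. -/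
structure StationaryBratteli where
  size : ℕ
  top : Fin size → ℕ
  inc : Matrix (Fin size) (Fin size) ℕ
  size_pos : 0 < size
  top_pos : ∀ v, 0 < top v
  exists_in : ∀ v, ∃ w, 0 < inc v w
  exists_out : ∀ w, ∃ v, 0 < inc v w

namespace StationaryBratteli

/-- Edges from level `0` to level `1`: a range vertex with an index. -/
abbrev TopEdge (B : StationaryBratteli) : Type := Σ v : Fin B.size, Fin (B.top v)

/-- Edges between two consecutive levels `n`, `n + 1` with `n ≥ 1`:
a pair (source, range) with an index. -/
abbrev Edge (B : StationaryBratteli) : Type :=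
  Σ p : Fin B.size × Fin B.size, Fin (B.inc p.2 p.1)

/-- The source of an edge. -/
def src {B : StationaryBratteli} (e : B.Edge) : Fin B.size := e.1.1

/-- The range of an edge. -/
def rng {B : StationaryBratteli} (e : B.Edge) : Fin B.size := e.1.2

/-- The space of infinite paths starting at the vertex of level `0`. A path consists of an edge
from level `0` to level `1`, and for each `n` an edge (with index `n`) from level `n + 1` to level
`n + 2`. The topology is the subspace topology of the product of the (finite, discrete) edge sets,
that is, the one generated by the cylinder sets. -/
abbrev Path (B : StationaryBratteli) : Type :=
  {x : B.TopEdge × (ℕ → B.Edge) //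
    x.1.1 = src (x.2 0) ∧ ∀ n, rng (x.2 n) = src (x.2 (n + 1))}

instance instMeasurableSpacePath (B : StationaryBratteli) : MeasurableSpace B.Path := borel _

instance instBorelSpacePath (B : StationaryBratteli) : BorelSpace B.Path := ⟨rfl⟩

/-- The vertex of level `n + 1` on the path `x`. -/
def vertex {B : StationaryBratteli} (x : B.Path) (n : ℕ) : Fin B.size := src (x.1.2 n)

/-- The cylinder set of the initial segment of `x` which joins level `0` to level `n + 1`. -/
def cylinder {B : StationaryBratteli} (x : B.Path) (n : ℕ) : Set B.Path :=
  {y | y.1.1 = x.1.1 ∧ ∀ k < n, y.1.2 k = x.1.2 k}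

/-- Tail equivalence: the paths agree from some level on. -/
def TailEquiv {B : StationaryBratteli} (x y : B.Path) : Prop :=
  ∃ N, ∀ n, N ≤ n → x.1.2 n = y.1.2 n

/-- The path space is a Cantor set. It is always nonempty, compact, metrizable and totally
disconnected, so only the absence of isolated points has to be required. -/
def IsCantor (B : StationaryBratteli) : Prop := PerfectSpace B.Path

/-- All classes of the tail equivalence relation are infinite. -/
def IsAperiodic (B : StationaryBratteli) : Prop := ∀ x : B.Path, {y | TailEquiv x y}.Infinite

/-- The diagram is simple: the tail equivalence relation is minimal, i.e. each class is dense. -/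
def IsSimple (B : StationaryBratteli) : Prop := ∀ x : B.Path, Dense {y | TailEquiv x y}

/-- A set of paths which is a union of tail equivalence classes. -/
def IsSaturated {B : StationaryBratteli} (A : Set B.Path) : Prop :=
  ∀ x y : B.Path, TailEquiv x y → x ∈ A → y ∈ A

/-- Minimal components: minimal nonempty closed unions of tail equivalence classes. -/
def minimalComponents (B : StationaryBratteli) : Set (Set B.Path) :=
  {A | Minimal (fun C : Set B.Path => IsClosed C ∧ C.Nonempty ∧ IsSaturated C) A}

/-- Invariance under tail equivalence: two finite paths from level `0` that end in the same vertex
have cylinder sets of the same measure. (Every finite path is an initial segment of an infinite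
one.) -/
def IsInvariant {B : StationaryBratteli} (μ : Measure B.Path) : Prop :=
  ∀ (n : ℕ) (x y : B.Path), vertex x n = vertex y n → μ (cylinder x n) = μ (cylinder y n)

/-- Ergodicity (for probability measures): saturated Borel sets have measure `0` or `1`. -/
def IsErgodic {B : StationaryBratteli} (μ : Measure B.Path) : Prop :=
  ∀ A : Set B.Path, MeasurableSet A → IsSaturated A → μ A = 0 ∨ μ A = 1

/-- Topological orbit equivalence of the tail equivalence relations. -/
def OrbitEquivalent (B C : StationaryBratteli) : Prop :=
  ∃ h : B.Path ≃ₜ C.Path, ∀ x y : B.Path, TailEquiv x y ↔ TailEquiv (h x) (h y)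

end StationaryBratteli

/-!
The proof needs neither the Perron–Frobenius theorem nor eigenvalues. The masses `p n v` of the
cylinders of level `n` at the vertex `v`, for an invariant measure, satisfy
`p n w = ∑ v, inc v w * p (n + 1) v`; such sequences are called harmonic here. For a matrix `M`
with positive entries, positive harmonic sequences contract negative parts
(`IsHarmonic.neg_part_contraction`): an integer vector `a` with `∑ v, a v * q n v > 0` becomes
positive after finitely many applications of `M` (`IsHarmonic.exists_iterate_pos`), and harmonic
sequences are unique up to a factor (`IsHarmonic.eq_smul`).

From the given measure `μ` one extracts such a matrix (`exists_positive_block`). Choose `k` such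
that `inc ^ k` has an idempotent pattern of positive entries. By ergodicity almost every path
visits some fixed vertex `e` infinitely often at multiples of `k`. The class of `e` is a block in
which all entries of `inc ^ k` are positive and which loses no mass. If `μ` is good, every small
cylinder has the measure of a clopen subset of a cylinder over `e`, so the clopen values of `μ`
are exactly the elements of `[0, 1]` in the group `G` generated by the masses in the block
(`exists_block_of_good`). After passing to a power the entries of `M` are at least `4`.

The diagram `B_i` consists of this block and of `i` sources, each with two loops and with edges
into the block whose numbers make a source as heavy as the whole block (`sourceBlock`). The first
edges are chosen by writing the unit of `G` as a combination of the masses with coefficients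
larger than `i`. A measure with the prescribed masses exists (`exists_measure_of_isHarmonic`), it is
ergodic because its masses are determined by harmonicity and their decay, and it is good because
sources only double from level to level while the surplus in the block grows at least fourfold
(`exists_isClopen_subset_measureReal`); so its clopen values are again `G ∩ [0, 1]`. Good measures
with the same clopen values are homeomorphic (`homeomorphicMeasures_of_clopen_values`). The
minimal components of `B_i`, `i ≥ 1`, are the sets of paths that stay at one source; their number,
and the simplicity of `B_0`, are invariants of orbit equivalence.
-/

/-! ### Good measures with the same clopen values are homeomorphic -/

/-- The code obtained by appending the digit that tells membership in `A`. -/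
noncomputable def appendDigit {X : Type*} (φ : X → ℕ) (A : Set X) (x : X) : ℕ :=
  open Classical in 2 * φ x + if x ∈ A then 1 else 0

theorem appendDigit_div {X : Type*} (φ : X → ℕ) (A : Set X) (x : X) :
    appendDigit φ A x / 2 = φ x := by
  unfold appendDigit
  split_ifs <;> omega

theorem mem_iff_of_appendDigit_eq {X : Type*} {φ : X → ℕ} {A : Set X} {x y : X}
    (h : appendDigit φ A x = appendDigit φ A y) : x ∈ A ↔ y ∈ A := by
  unfold appendDigit at h
  split_ifs at h <;> first | tauto | omega

theorem appendDigit_preimage_even {X : Type*} (φ : X → ℕ) (A : Set X) (k : ℕ) :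
    appendDigit φ A ⁻¹' {2 * k} = φ ⁻¹' {k} \ (A ∩ φ ⁻¹' {k}) := by
  ext x
  simp only [appendDigit, Set.mem_preimage, Set.mem_singleton_iff, Set.mem_sdiff, Set.mem_inter_iff]
  split_ifs with h
  · simp only [h, true_and, and_not_self, iff_false]; omega
  · simp only [h, false_and, not_false_eq_true, and_true]; omega

theorem appendDigit_preimage_odd {X : Type*} (φ : X → ℕ) (A : Set X) (k : ℕ) :
    appendDigit φ A ⁻¹' {2 * k + 1} = A ∩ φ ⁻¹' {k} := by
  ext x
  simp only [appendDigit, Set.mem_preimage, Set.mem_singleton_iff, Set.mem_inter_iff]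
  split_ifs with h
  · simp only [h, true_and]; omega
  · simp only [h, false_and, iff_false]; omega

theorem continuous_appendDigit {X : Type*} [TopologicalSpace X] {φ : X → ℕ} (hφ : Continuous φ)
    {A : Set X} (hA : IsClopen A) :
    Continuous (appendDigit φ A) := by
  classical
  refine (continuous_const.mul hφ).add ?_
  refine continuous_if (fun a ha => ?_) continuous_const.continuousOn continuous_const.continuousOn
  change a ∈ frontier A at ha
  rw [hA.frontier_eq] at ha
  exact ha.elim

section GoodMeasures

variable {X Y : Type*} [TopologicalSpace X] [TopologicalSpace Y]
  [MeasurableSpace X] [MeasurableSpace Y]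

/-- A pair of codings of two spaces by natural numbers, such that corresponding cells are clopen
and have the same measure. Clopenness of the cells is encoded as continuity into the discrete space
`ℕ`; refinements are made by appending a binary digit to the code. -/
structure IsMatchedCoding (μ : Measure X) (ν : Measure Y) (φ : X → ℕ) (ψ : Y → ℕ) : Prop where
  continuous_left : Continuous φ
  continuous_right : Continuous ψ
  measure_eq : ∀ k, μ (φ ⁻¹' {k}) = ν (ψ ⁻¹' {k})

theorem IsMatchedCoding.symm {μ : Measure X} {ν : Measure Y} {φ : X → ℕ} {ψ : Y → ℕ}
    (h : IsMatchedCoding μ ν φ ψ) : IsMatchedCoding ν μ ψ φ :=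
  ⟨h.2, h.1, fun k => (h.3 k).symm⟩

/-- Goodness of the second measure allows to follow a refinement of the first coding. -/
theorem IsMatchedCoding.exists_append [BorelSpace X] [BorelSpace Y] {μ : Measure X} {ν : Measure Y}
    [IsFiniteMeasure μ] [IsFiniteMeasure ν]
    (hν : ∀ V : Set Y, IsClopen V → IsGoodClopen ν V)
    (hval : ∀ U : Set X, IsClopen U → ∃ V : Set Y, IsClopen V ∧ ν V = μ U)
    {φ : X → ℕ} {ψ : Y → ℕ} (h : IsMatchedCoding μ ν φ ψ) {A : Set X} (hA : IsClopen A) :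
    ∃ B : Set Y, IsMatchedCoding μ ν (appendDigit φ A) (appendDigit ψ B) := by
  have hcl : ∀ k, IsClopen (ψ ⁻¹' {k}) := fun k => (isClopen_discrete _).preimage h.2
  have hcl' : ∀ k, IsClopen (φ ⁻¹' {k}) := fun k => (isClopen_discrete _).preimage h.1
  have key : ∀ k, ∃ W : Set Y, IsClopen W ∧ W ⊆ ψ ⁻¹' {k} ∧ ν W = μ (A ∩ φ ⁻¹' {k}) := by
    intro k
    have hle : μ (A ∩ φ ⁻¹' {k}) ≤ ν (ψ ⁻¹' {k}) :=
      (measure_mono Set.inter_subset_right).trans (h.3 k).le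
    rcases hle.lt_or_eq with hlt | heq
    · obtain ⟨V, hV, hVU⟩ := hval _ (hA.inter (hcl' k))
      obtain ⟨W, hW, hWV, hWm⟩ := hν _ (hcl k) V hV (hVU ▸ hlt)
      exact ⟨W, hW, hWV, hWm.trans hVU⟩
    · exact ⟨_, hcl k, subset_rfl, heq.symm⟩
  choose W hW hWsub hWm using key
  have hB : ∀ k, (⋃ j, W j) ∩ ψ ⁻¹' {k} = W k := by
    intro k
    ext y
    constructor
    · rintro ⟨hy, hk⟩
      obtain ⟨j, hj⟩ := Set.mem_iUnion.1 hy
      have h1 : ψ y = j := hWsub j hj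
      have h2 : ψ y = k := hk
      rw [← h2, h1]; exact hj
    · exact fun hy => ⟨Set.mem_iUnion.2 ⟨k, hy⟩, hWsub k hy⟩
  have hBcl : IsClopen (⋃ j, W j) := by
    refine ⟨⟨?_⟩, isOpen_iUnion fun j => (hW j).2⟩
    have : (⋃ j, W j)ᶜ = ⋃ k, ψ ⁻¹' {k} \ W k := by
      ext y
      simp only [Set.mem_compl_iff, Set.mem_iUnion, Set.mem_sdiff]
      constructor
      · exact fun hy => ⟨ψ y, rfl, fun h' => hy ⟨_, h'⟩⟩
      · rintro ⟨k, hk, hy⟩ ⟨j, hj⟩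
        have h1 : ψ y = j := hWsub j hj
        have h2 : ψ y = k := hk
        rw [← h2, h1] at hy; exact hy hj
    rw [this]
    exact isOpen_iUnion fun k => ((hcl k).diff (hW k)).2
  refine ⟨⋃ j, W j, continuous_appendDigit h.1 hA, continuous_appendDigit h.2 hBcl, fun k => ?_⟩
  rcases Nat.even_or_odd' k with ⟨k, rfl | rfl⟩
  · rw [appendDigit_preimage_even, appendDigit_preimage_even, hB,
      measure_sdiff (hWsub k) (hW k).2.measurableSet.nullMeasurableSet (measure_ne_top _ _),
      measure_sdiff Set.inter_subset_right
        (hA.inter (hcl' k)).2.measurableSet.nullMeasurableSet (measure_ne_top _ _), hWm, h.3]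
  · rw [appendDigit_preimage_odd, appendDigit_preimage_odd, hB, hWm]

theorem IsMatchedCoding.measure_preimage [BorelSpace X] [BorelSpace Y] {μ : Measure X}
    {ν : Measure Y} {φ : X → ℕ} {ψ : Y → ℕ} (h : IsMatchedCoding μ ν φ ψ) (T : Set ℕ) :
    μ (φ ⁻¹' T) = ν (ψ ⁻¹' T) := by
  have : μ.map φ = ν.map ψ := by
    refine Measure.ext_of_singleton fun k => ?_
    rw [Measure.map_apply h.1.measurable (measurableSet_singleton k),
      Measure.map_apply h.2.measurable (measurableSet_singleton k), h.3]
  rw [← Measure.map_apply h.1.measurable (MeasurableSet.of_discrete), this,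
    Measure.map_apply h.2.measurable (MeasurableSet.of_discrete)]

/-- Compactness: a code sequence realised at finite stages by points of the second space is
realised by a single point. Fullness of `μ` makes the cells of the second coding nonempty. -/
theorem exists_same_codes [CompactSpace Y] [BorelSpace X] [BorelSpace Y]
    {μ : Measure X} {ν : Measure Y} (hμ : IsFull μ)
    {φ : ℕ → X → ℕ} {ψ : ℕ → Y → ℕ} (h : ∀ n, IsMatchedCoding μ ν (φ n) (ψ n))
    (hφ : ∀ n x, φ (n + 1) x / 4 = φ n x) (hψ : ∀ n y, ψ (n + 1) y / 4 = ψ n y) (x : X) :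
    ∃ y, ∀ n, ψ n y = φ n x := by
  have hne := IsCompact.nonempty_iInter_of_sequence_nonempty_isCompact_isClosed
    (fun n => ψ n ⁻¹' {φ n x}) (fun n y hy => ?_) (fun n => ?_) ?_ (fun n => ?_)
  · obtain ⟨y, hy⟩ := hne
    exact ⟨y, fun n => Set.mem_iInter.1 hy n⟩
  · have hy : ψ (n + 1) y = φ (n + 1) x := hy
    change ψ n y = φ n x
    rw [← hψ, ← hφ, hy]
  · refine nonempty_of_measure_ne_zero (μ := ν) ?_
    rw [← (h n).3]
    exact (hμ (φ n ⁻¹' {φ n x}) ((isClopen_discrete _).preimage (h n).1) ⟨x, rfl⟩).ne'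
  · exact ((isClosed_discrete _).preimage (h 0).2).isCompact
  · exact (isClosed_discrete _).preimage (h n).2

theorem borel_eq_generateFrom_isClopen {X : Type*} [TopologicalSpace X] [CompactSpace X] [T2Space X]
    [TotallyDisconnectedSpace X] [SecondCountableTopology X] [MeasurableSpace X] [BorelSpace X] :
    ‹MeasurableSpace X› = MeasurableSpace.generateFrom {s : Set X | IsClopen s} := by
  rw [BorelSpace.measurable_eq (α := X)]
  exact borel_eq_generateFrom_of_subbasis
    (loc_compact_Haus_tot_disc_of_zero_dim (H := X)).eq_generateFrom

variable [CompactSpace X] [T2Space X] [TotallyDisconnectedSpace X] [SecondCountableTopology X]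
  [BorelSpace X] [CompactSpace Y] [T2Space Y] [TotallyDisconnectedSpace Y]
  [SecondCountableTopology Y] [BorelSpace Y]

/-- Akin's theorem: good probability measures on compact zero-dimensional metrizable spaces with
the same clopen values are homeomorphic. All clopen sets of both spaces are exhausted by a
back-and-forth sequence of matched codings, and points with the same codes correspond. -/
theorem homeomorphicMeasures_of_clopen_values {μ : Measure X} {ν : Measure Y}
    [IsProbabilityMeasure μ] [IsProbabilityMeasure ν] (hμ : IsGoodMeasure μ) (hν : IsGoodMeasure ν)
    (hμν : ∀ U : Set X, IsClopen U → ∃ V : Set Y, IsClopen V ∧ ν V = μ U)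
    (hνμ : ∀ V : Set Y, IsClopen V → ∃ U : Set X, IsClopen U ∧ μ U = ν V) :
    HomeomorphicMeasures μ ν := by
  have : Countable (TopologicalSpace.Clopens X) :=
    TopologicalSpace.Clopens.countable_iff_secondCountable.2 inferInstance
  have : Countable (TopologicalSpace.Clopens Y) :=
    TopologicalSpace.Clopens.countable_iff_secondCountable.2 inferInstance
  obtain ⟨A, hA⟩ := exists_surjective_nat (TopologicalSpace.Clopens X)
  obtain ⟨B, hB⟩ := exists_surjective_nat (TopologicalSpace.Clopens Y)
  -- every step appends two digits, the first for a clopen set of `X`, the second for one of `Y`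
  have step : ∀ (n : ℕ) (s : {p : (X → ℕ) × (Y → ℕ) // IsMatchedCoding μ ν p.1 p.2}),
      ∃ t : {p : (X → ℕ) × (Y → ℕ) // IsMatchedCoding μ ν p.1 p.2},
        (∀ x, t.1.1 x / 4 = s.1.1 x) ∧ (∀ y, t.1.2 y / 4 = s.1.2 y) ∧
        (∀ x x', t.1.1 x = t.1.1 x' → (x ∈ A n ↔ x' ∈ A n)) ∧
        (∀ y y', t.1.2 y = t.1.2 y' → (y ∈ B n ↔ y' ∈ B n)) := by
    rintro n ⟨⟨φ, ψ⟩, hs⟩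
    obtain ⟨C, hC⟩ := hs.exists_append hν.good hμν (A n).isClopen
    obtain ⟨D, hD⟩ := hC.symm.exists_append hμ.good hνμ (B n).isClopen
    have h4 : ∀ a : ℕ, a / 4 = a / 2 / 2 := fun a => by omega
    refine ⟨⟨(_, _), hD.symm⟩, fun x => ?_, fun y => ?_, fun x x' hx => ?_, fun y y' hy => ?_⟩
    · rw [h4]; exact (congrArg (· / 2) (appendDigit_div _ D x)).trans (appendDigit_div _ _ x)
    · rw [h4]; exact (congrArg (· / 2) (appendDigit_div _ _ y)).trans (appendDigit_div _ C y)
    · refine mem_iff_of_appendDigit_eq (φ := φ) ?_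
      rw [← appendDigit_div (appendDigit φ _) D x, ← appendDigit_div (appendDigit φ _) D x']
      exact congrArg (· / 2) hx
    · exact mem_iff_of_appendDigit_eq hy
  have h0 : IsMatchedCoding μ ν (fun _ => 0) (fun _ => 0) := by
    refine ⟨continuous_const, continuous_const, fun k => ?_⟩
    by_cases hk : (0 : ℕ) = k <;> simp [Set.preimage, hk]
  choose next hnext using step
  let s : ℕ → {p : (X → ℕ) × (Y → ℕ) // IsMatchedCoding μ ν p.1 p.2} :=
    fun n => Nat.rec ⟨(_, _), h0⟩ next n
  let φ : ℕ → X → ℕ := fun n => (s n).1.1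
  let ψ : ℕ → Y → ℕ := fun n => (s n).1.2
  have hm : ∀ n, IsMatchedCoding μ ν (φ n) (ψ n) := fun n => (s n).2
  have hφ : ∀ n x, φ (n + 1) x / 4 = φ n x := fun n => (hnext n (s n)).1
  have hψ : ∀ n y, ψ (n + 1) y / 4 = ψ n y := fun n => (hnext n (s n)).2.1
  have hAφ : ∀ n x x', φ (n + 1) x = φ (n + 1) x' → (x ∈ A n ↔ x' ∈ A n) :=
    fun n => (hnext n (s n)).2.2.1
  have hBψ : ∀ n y y', ψ (n + 1) y = ψ (n + 1) y' → (y ∈ B n ↔ y' ∈ B n) :=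
    fun n => (hnext n (s n)).2.2.2
  let Φ : X → ℕ → ℕ := fun x n => φ n x
  let Ψ : Y → ℕ → ℕ := fun y n => ψ n y
  have hΦc : Continuous Φ := continuous_pi fun n => (hm n).1
  have hΨc : Continuous Ψ := continuous_pi fun n => (hm n).2
  have hΦi : Function.Injective Φ := by
    intro x x' hxx
    by_contra hne
    obtain ⟨U, hU, hxU, hxU'⟩ := exists_isClopen_of_totally_separated hne
    obtain ⟨n, hn⟩ := hA ⟨U, hU⟩
    have hx := hAφ n x x' (congrFun hxx (n + 1))
    rw [hn] at hx
    exact hxU' (hx.1 hxU)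
  have hΨi : Function.Injective Ψ := by
    intro x x' hxx
    by_contra hne
    obtain ⟨U, hU, hxU, hxU'⟩ := exists_isClopen_of_totally_separated hne
    obtain ⟨n, hn⟩ := hB ⟨U, hU⟩
    have hx := hBψ n x x' (congrFun hxx (n + 1))
    rw [hn] at hx
    exact hxU' (hx.1 hxU)
  have hrange : Set.range Φ = Set.range Ψ := by
    apply Set.Subset.antisymm
    · rintro _ ⟨x, rfl⟩
      obtain ⟨y, hy⟩ := exists_same_codes hμ.full hm hφ hψ x
      exact ⟨y, funext hy⟩
    · rintro _ ⟨y, rfl⟩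
      obtain ⟨x, hx⟩ := exists_same_codes hν.full (fun n => (hm n).symm) hψ hφ y
      exact ⟨x, funext hx⟩
  let h : X ≃ₜ Y := ((hΦc.isClosedEmbedding hΦi).isEmbedding.toHomeomorph.trans
    (Homeomorph.setCongr hrange)).trans (hΨc.isClosedEmbedding hΨi).isEmbedding.toHomeomorph.symm
  have hh : ∀ x, Ψ (h x) = Φ x := by
    intro x
    have := (hΨc.isClosedEmbedding hΨi).isEmbedding.toHomeomorph.apply_symm_apply
      (Homeomorph.setCongr hrange
        ((hΦc.isClosedEmbedding hΦi).isEmbedding.toHomeomorph x))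
    exact congrArg Subtype.val this
  refine ⟨h, ?_⟩
  refine ext_of_generate_finite {s | IsClopen s} borel_eq_generateFrom_isClopen
    (fun s hs t ht _ => hs.inter ht) (fun V hV => ?_) ?_
  · rw [Measure.map_apply h.continuous.measurable (IsOpen.measurableSet hV.2)]
    obtain ⟨n, hn⟩ := hB ⟨V, hV⟩
    -- `V` is a union of cells of the code `ψ (n + 1)`
    have hV' : V = ψ (n + 1) ⁻¹' (ψ (n + 1) '' V) := by
      refine (Set.subset_preimage_image _ _).antisymm ?_
      rintro y ⟨y', hy', hyy⟩
      have := hBψ n y' y hyy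
      rw [hn] at this
      exact this.1 hy'
    have hpre : h ⁻¹' V = φ (n + 1) ⁻¹' (ψ (n + 1) '' V) := by
      ext x
      have hx : ψ (n + 1) (h x) = φ (n + 1) x := congrFun (hh x) (n + 1)
      conv_lhs => rw [hV']
      simp only [Set.mem_preimage, hx]
    exact (congrArg μ hpre).trans (((hm (n + 1)).measure_preimage _).trans (congrArg ν hV'.symm))
  · rw [Measure.map_apply h.continuous.measurable MeasurableSet.univ]
    simp

end GoodMeasures

/-! ### Positive matrices along a harmonic sequence -/

section PositiveMatrix

open Matrix

variable {E : Type*} [Fintype E]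

/-- A sequence of vectors that are pulled back to each other by the transpose of a nonnegative
integer matrix `M`: the vectors of cylinder masses of an invariant measure on a stationary
diagram have this property. -/
def IsHarmonic (M : Matrix E E ℕ) (q : ℕ → E → ℝ) : Prop :=
  ∀ n w, q n w = ∑ v, (M v w : ℝ) * q (n + 1) v

/-- The real matrix with the entries of `M`, acting on column vectors. -/
def pushVec (M : Matrix E E ℕ) (a : E → ℝ) : E → ℝ := fun v => ∑ w, (M v w : ℝ) * a w

theorem IsHarmonic.sum_mul_pushVec {M : Matrix E E ℕ} {q : ℕ → E → ℝ} (h : IsHarmonic M q)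
    (n : ℕ) (a : E → ℝ) : ∑ v, q (n + 1) v * pushVec M a v = ∑ w, q n w * a w := by
  simp only [pushVec, Finset.mul_sum, h n, Finset.sum_mul]
  rw [Finset.sum_comm]
  refine Finset.sum_congr rfl fun w _ => Finset.sum_congr rfl fun v _ => by ring

theorem IsHarmonic.sum_mul_iterate {M : Matrix E E ℕ} {q : ℕ → E → ℝ} (h : IsHarmonic M q)
    (n j : ℕ) (a : E → ℝ) :
    ∑ v, q (n + j) v * ((pushVec M)^[j] a) v = ∑ w, q n w * a w := by
  induction j with
  | zero => simp
  | succ j ih => rw [Function.iterate_succ_apply', ← add_assoc, h.sum_mul_pushVec, ih]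

/-- One step of the contraction: the mass of the negative part of a vector of nonnegative total
mass shrinks by a definite factor, because every entry of the image receives a definite share of
both the positive and the negative part, and these shares cancel. -/
theorem IsHarmonic.neg_part_contraction {M : Matrix E E ℕ} {q : ℕ → E → ℝ} (h : IsHarmonic M q)
    (hq : ∀ n v, 0 < q n v) (hM : ∀ v w, 1 ≤ M v w) {K : ℝ} (hK : 0 < K)
    (hMK : ∀ v w, (M v w : ℝ) ≤ K) (n : ℕ) (a : E → ℝ) (ha : 0 ≤ ∑ w, q n w * a w) :
    ∑ v, q (n + 1) v * (pushVec M a v)⁻ ≤ (1 - 1 / K) * ∑ w, q n w * (a w)⁻ := by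
  set N := ∑ w, q n w * (a w)⁻ with hN
  set Q := ∑ v, q (n + 1) v with hQ
  have hQ0 : 0 ≤ Q := Finset.sum_nonneg fun v _ => (hq _ _).le
  set A := pushVec M fun w => (a w)⁺ with hA
  set B := pushVec M fun w => (a w)⁻ with hB
  have hqK : ∀ w, q n w ≤ K * Q := by
    intro w
    rw [h n w, hQ, Finset.mul_sum]
    exact Finset.sum_le_sum fun v _ => mul_le_mul_of_nonneg_right (hMK v w) (hq _ _).le
  have hAB : ∀ v, pushVec M a v = A v - B v := by
    intro v
    simp only [hA, hB, pushVec, ← Finset.sum_sub_distrib, ← mul_sub, posPart_sub_negPart]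
  have hS : N ≤ ∑ w, q n w * (a w)⁺ := by
    have : ∑ w, q n w * a w = ∑ w, q n w * (a w)⁺ - N := by
      rw [hN, ← Finset.sum_sub_distrib]
      refine Finset.sum_congr rfl fun w _ => ?_
      rw [← mul_sub, posPart_sub_negPart]
    linarith
  -- every entry of the image of a nonnegative vector is at least its coordinate sum
  have low : ∀ (b : E → ℝ), (∀ w, 0 ≤ b w) → ∀ v,
      ∑ w, q n w * b w ≤ K * Q * pushVec M b v := by
    intro b hb v
    rw [pushVec, Finset.mul_sum]
    refine Finset.sum_le_sum fun w _ => ?_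
    have h1 : b w ≤ (M v w : ℝ) * b w := le_mul_of_one_le_left (hb w) (by exact_mod_cast hM v w)
    exact mul_le_mul (hqK w) h1 (hb w) (mul_nonneg hK.le hQ0)
  have hAl : ∀ v, N ≤ K * Q * A v := fun v => hS.trans (low _ (fun w => posPart_nonneg _) v)
  have hBl : ∀ v, N ≤ K * Q * B v := fun v => low _ (fun w => negPart_nonneg _) v
  have hBsum : ∑ v, q (n + 1) v * B v = N := h.sum_mul_pushVec n _
  have hneg : ∀ v, (pushVec M a v)⁻ = B v - min (A v) (B v) := by
    intro v
    rw [hAB, negPart_def]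
    rcases le_total (A v) (B v) with h' | h'
    · rw [min_eq_left h', neg_sub]; exact sup_eq_left.2 (by linarith)
    · rw [min_eq_right h', neg_sub, sub_self]; exact sup_eq_right.2 (by linarith)
  have hmin : N ≤ K * ∑ v, q (n + 1) v * min (A v) (B v) := by
    rcases hQ0.eq_or_lt with h0 | hpos
    · have hE : ∀ v : E, False := fun v => by
        have := Finset.single_le_sum (fun v _ => (hq (n + 1) v).le) (Finset.mem_univ v)
        have := hq (n + 1) v
        linarith
      have : N = 0 := Finset.sum_eq_zero fun v _ => (hE v).elim
      rw [this, Finset.sum_eq_zero fun v _ => (hE v).elim, mul_zero]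
    · have : ∀ v, N / (K * Q) ≤ min (A v) (B v) := fun v =>
        le_min ((div_le_iff₀' (by positivity)).2 (hAl v)) ((div_le_iff₀' (by positivity)).2 (hBl v))
      calc N = K * ∑ v, q (n + 1) v * (N / (K * Q)) := by
            rw [← Finset.sum_mul, ← hQ]; field_simp
        _ ≤ _ := mul_le_mul_of_nonneg_left (Finset.sum_le_sum fun v _ =>
            mul_le_mul_of_nonneg_left (this v) (hq _ _).le) hK.le
  calc ∑ v, q (n + 1) v * (pushVec M a v)⁻
      = N - ∑ v, q (n + 1) v * min (A v) (B v) := by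
        rw [← hBsum, ← Finset.sum_sub_distrib]
        exact Finset.sum_congr rfl fun v _ => by rw [hneg]; ring
    _ ≤ (1 - 1 / K) * N := by
        have : 1 / K * N ≤ ∑ v, q (n + 1) v * min (A v) (B v) := by
          rw [one_div, inv_mul_le_iff₀ hK]; exact hmin
        linarith

/-- Perron–Frobenius positivity: a vector of positive mass becomes positive. -/
theorem IsHarmonic.exists_iterate_pos {M : Matrix E E ℕ} {q : ℕ → E → ℝ} (h : IsHarmonic M q)
    (hq : ∀ n v, 0 < q n v) (hM : ∀ v w, 1 ≤ M v w) (n : ℕ) (a : E → ℝ)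
    (ha : 0 < ∑ w, q n w * a w) : ∃ j, ∀ v, 0 < ((pushVec M)^[j] a) v := by
  set s := ∑ w, q n w * a w with hs
  obtain ⟨K, hK1, hMK⟩ : ∃ K : ℝ, 1 ≤ K ∧ ∀ v w, (M v w : ℝ) ≤ K := by
    refine ⟨1 + ∑ v, ∑ w, (M v w : ℝ), ?_, fun v w => ?_⟩
    · have : (0 : ℝ) ≤ ∑ v, ∑ w, (M v w : ℝ) := by positivity
      linarith
    · have h1 : (M v w : ℝ) ≤ ∑ w, (M v w : ℝ) :=
        Finset.single_le_sum (f := fun w => (M v w : ℝ)) (fun _ _ => by positivity)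
          (Finset.mem_univ w)
      have h2 : ∑ w, (M v w : ℝ) ≤ ∑ v, ∑ w, (M v w : ℝ) :=
        Finset.single_le_sum (f := fun v => ∑ w, (M v w : ℝ)) (fun _ _ => by positivity)
          (Finset.mem_univ v)
      linarith
  have hK : 0 < K := by linarith
  have hmass : ∀ j, ∑ v, q (n + j) v * ((pushVec M)^[j] a) v = s := fun j => h.sum_mul_iterate n j a
  have hN : ∀ j, ∑ v, q (n + j) v * (((pushVec M)^[j] a) v)⁻
      ≤ (1 - 1 / K) ^ j * ∑ v, q n v * (a v)⁻ := by
    intro j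
    induction j with
    | zero => simp
    | succ j ih =>
      have h1 := h.neg_part_contraction hq hM hK hMK (n + j) ((pushVec M)^[j] a)
        (by rw [hmass]; exact ha.le)
      have hr : 0 ≤ 1 - 1 / K := by
        have : 1 / K ≤ 1 := by rw [div_le_one hK]; exact hK1
        linarith
      rw [Function.iterate_succ_apply']
      refine h1.trans ?_
      rw [pow_succ', mul_assoc]
      exact mul_le_mul_of_nonneg_left ih hr
  have hlim : Filter.Tendsto (fun j => (1 - 1 / K) ^ j * ∑ v, q n v * (a v)⁻) Filter.atTop
      (𝓝 (0 * ∑ v, q n v * (a v)⁻)) := by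
    refine (tendsto_pow_atTop_nhds_zero_of_lt_one ?_ ?_).mul_const _
    · have : 1 / K ≤ 1 := by rw [div_le_one hK]; exact hK1
      linarith
    · have : 0 < 1 / K := by positivity
      linarith
  rw [zero_mul] at hlim
  obtain ⟨j, hj⟩ := (hlim.eventually (gt_mem_nhds (show (0 : ℝ) < s / K ^ 2 by positivity))).exists
  refine ⟨j + 1, fun v => ?_⟩
  rw [Function.iterate_succ_apply']
  set b := (pushVec M)^[j] a with hb
  set N := ∑ v, q (n + j) v * (b v)⁻ with hNdef
  have hNlt : N < s / K ^ 2 := (hN j).trans_lt hj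
  set Q := ∑ v, q (n + j + 1) v with hQ
  have hQ0 : 0 < Q := Finset.sum_pos (fun v _ => hq _ _) ⟨v, Finset.mem_univ v⟩
  have hqK : ∀ w, q (n + j) w ≤ K * Q := by
    intro w
    rw [h _ w, hQ, Finset.mul_sum]
    exact Finset.sum_le_sum fun v _ => mul_le_mul_of_nonneg_right (hMK v w) (hq _ _).le
  have hqQ : ∀ w, Q ≤ q (n + j) w := by
    intro w
    rw [h _ w, hQ]
    exact Finset.sum_le_sum fun v _ =>
      le_mul_of_one_le_left (hq _ _).le (by exact_mod_cast hM v w)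
  have hpos : s + N = ∑ w, q (n + j) w * (b w)⁺ := by
    rw [← hmass j, hNdef, ← Finset.sum_add_distrib]
    refine Finset.sum_congr rfl fun w _ => ?_
    rw [← mul_add]
    congr 1
    rw [← hb]
    linarith [posPart_sub_negPart (b w)]
  have h1 : s + N ≤ K * Q * ∑ w, (b w)⁺ := by
    rw [hpos, Finset.mul_sum]
    exact Finset.sum_le_sum fun w _ => mul_le_mul_of_nonneg_right (hqK w) (posPart_nonneg _)
  have h2 : Q * ∑ w, (b w)⁻ ≤ N := by
    rw [hNdef, Finset.mul_sum]
    exact Finset.sum_le_sum fun w _ => mul_le_mul_of_nonneg_right (hqQ w) (negPart_nonneg _)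
  have hN0 : 0 ≤ N := Finset.sum_nonneg fun w _ => mul_nonneg (hq _ _).le (negPart_nonneg _)
  have h3 : ∑ w, (b w)⁺ - K * ∑ w, (b w)⁻ ≤ pushVec M b v := by
    rw [pushVec, Finset.mul_sum, ← Finset.sum_sub_distrib]
    refine Finset.sum_le_sum fun w _ => ?_
    have e1 : (b w)⁺ ≤ (M v w : ℝ) * (b w)⁺ :=
      le_mul_of_one_le_left (posPart_nonneg _) (by exact_mod_cast hM v w)
    have e2 : (M v w : ℝ) * (b w)⁻ ≤ K * (b w)⁻ :=
      mul_le_mul_of_nonneg_right (hMK v w) (negPart_nonneg _)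
    have e3 : b w = (b w)⁺ - (b w)⁻ := (posPart_sub_negPart _).symm
    calc (b w)⁺ - K * (b w)⁻ ≤ (M v w : ℝ) * ((b w)⁺ - (b w)⁻) := by rw [mul_sub]; linarith
      _ = _ := by rw [← e3]
  refine lt_of_lt_of_le ?_ h3
  have h4 : K ^ 2 * N < s := by
    rw [lt_div_iff₀ (by positivity)] at hNlt; linarith
  -- compare after multiplication by `K * Q`
  have h5 : K * Q * (K * ∑ w, (b w)⁻) ≤ K ^ 2 * N := by
    nlinarith [mul_le_mul_of_nonneg_left h2 (sq_nonneg K)]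
  have h6 : 0 < K * Q * (∑ w, (b w)⁺ - K * ∑ w, (b w)⁻) := by rw [mul_sub]; linarith
  exact pos_of_mul_pos_right h6 (by positivity)

/-- Uniqueness of nonnegative harmonic sequences up to a factor. -/
theorem IsHarmonic.eq_smul [Nonempty E] {M : Matrix E E ℕ} {q f : ℕ → E → ℝ} (h : IsHarmonic M q)
    (hq : ∀ n v, 0 < q n v) (hM : ∀ v w, 1 ≤ M v w) (hf : IsHarmonic M f)
    (hf0 : ∀ n v, 0 ≤ f n v) : ∃ c : ℝ, ∀ n v, f n v = c * q n v := by
  classical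
  have half : ∀ n w w', f n w' * q n w ≤ f n w * q n w' := by
    intro n w w'
    refine le_of_forall_pos_lt_add fun ε hε => ?_
    -- a test vector of mass `δ * q n w`, supported on `w` and `w'`
    have key : ∀ δ : ℝ, 0 < δ → 0 ≤ f n w * (q n w' + δ) - f n w' * q n w := by
      intro δ hδ
      set a : E → ℝ := Pi.single w (q n w' + δ) - Pi.single w' (q n w) with ha
      have hsum : ∀ g : E → ℝ, ∑ v, g v * a v = g w * (q n w' + δ) - g w' * q n w := by
        intro g
        simp [ha, mul_sub, Finset.sum_sub_distrib, Pi.single_apply]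
      obtain ⟨j, hj⟩ := h.exists_iterate_pos hq hM n a (by
        rw [hsum]; have := mul_pos hδ (hq n w); nlinarith)
      rw [← hsum (f n), ← hf.sum_mul_iterate n j a]
      exact Finset.sum_nonneg fun v _ => mul_nonneg (hf0 _ _) (hj v).le
    have h1 := key (ε / (2 * (f n w + 1))) (by have := hf0 n w; positivity)
    have h2 : f n w * (ε / (2 * (f n w + 1))) < ε := by
      have := hf0 n w
      rw [mul_div_assoc', div_lt_iff₀ (by positivity)]
      nlinarith
    rw [mul_add] at h1
    linarith
  have hcross : ∀ n w w', f n w' * q n w = f n w * q n w' := fun n w w' =>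
    (half n w w').antisymm (half n w' w)
  obtain ⟨e⟩ := ‹Nonempty E›
  have hc : ∀ n v, f n v = f n e / q n e * q n v := fun n v => by
    have := hcross n e v
    have hne := (hq n e).ne'
    field_simp
    linarith
  have hcs : ∀ n, f n e / q n e = f 0 e / q 0 e := by
    intro n
    induction n with
    | zero => rfl
    | succ n ih =>
      rw [← ih, eq_div_iff (hq n e).ne', hf n e, h n e, Finset.mul_sum]
      refine Finset.sum_congr rfl fun v _ => ?_
      rw [hc (n + 1) v]
      ring
  exact ⟨f 0 e / q 0 e, fun n v => by rw [← hcs n]; exact hc n v⟩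

end PositiveMatrix

/-! ### Cylinder sets and tail equivalence -/

namespace StationaryBratteli

variable {B : StationaryBratteli}

section Paths

theorem rng_eq_vertex_succ (x : B.Path) (n : ℕ) : rng (x.1.2 n) = vertex x (n + 1) := x.2.2 n

theorem top_fst_eq_vertex (x : B.Path) : x.1.1.1 = vertex x 0 := x.2.1

theorem mem_cylinder_self (x : B.Path) (n : ℕ) : x ∈ cylinder x n := ⟨rfl, fun _ _ => rfl⟩

theorem cylinder_anti (x : B.Path) {n m : ℕ} (h : n ≤ m) : cylinder x m ⊆ cylinder x n :=
  fun _ hy => ⟨hy.1, fun k hk => hy.2 k (hk.trans_le h)⟩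

theorem cylinder_eq_of_mem {x y : B.Path} {n : ℕ} (h : y ∈ cylinder x n) :
    cylinder y n = cylinder x n := by
  ext z
  exact ⟨fun hz => ⟨hz.1.trans h.1, fun k hk => (hz.2 k hk).trans (h.2 k hk)⟩,
    fun hz => ⟨hz.1.trans h.1.symm, fun k hk => (hz.2 k hk).trans (h.2 k hk).symm⟩⟩

theorem mem_cylinder_comm {x y : B.Path} {n : ℕ} : y ∈ cylinder x n ↔ x ∈ cylinder y n :=
  ⟨fun h => cylinder_eq_of_mem h ▸ mem_cylinder_self x n,
    fun h => cylinder_eq_of_mem h ▸ mem_cylinder_self y n⟩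

theorem disjoint_cylinder_of_notMem {x y : B.Path} {n : ℕ} (h : y ∉ cylinder x n) :
    Disjoint (cylinder x n) (cylinder y n) := by
  refine Set.disjoint_left.2 fun z hx hy => h ?_
  rw [← cylinder_eq_of_mem hx]
  exact mem_cylinder_comm.1 hy

theorem vertex_eq_of_mem_cylinder {x y : B.Path} {n : ℕ} (h : y ∈ cylinder x n) {k : ℕ}
    (hk : k ≤ n) : vertex y k = vertex x k := by
  cases k with
  | zero => rw [← top_fst_eq_vertex, ← top_fst_eq_vertex, h.1]
  | succ k => rw [← rng_eq_vertex_succ, ← rng_eq_vertex_succ, h.2 k hk]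

/-- The path that follows `x` up to level `n + 1` and then the edges `f 0, f 1, …`. -/
def splice (x : B.Path) (n : ℕ) (f : ℕ → B.Edge) (h0 : src (f 0) = vertex x n)
    (hf : ∀ k, rng (f k) = src (f (k + 1))) : B.Path :=
  ⟨(x.1.1, fun k => if k < n then x.1.2 k else f (k - n)), by
    constructor
    · rcases Nat.eq_zero_or_pos n with rfl | hn
      · simpa [h0] using top_fst_eq_vertex x
      · simpa [hn] using x.2.1
    · intro k
      rcases lt_trichotomy (k + 1) n with h | h | h
      · simpa [h, (Nat.lt_succ_self k).trans h] using x.2.2 k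
      · subst h
        simpa [h0] using rng_eq_vertex_succ x k
      · have h1 : ¬ k < n := by omega
        have h2 : ¬ k + 1 < n := by omega
        have h3 : k + 1 - n = k - n + 1 := by omega
        simpa [h1, h2, h3] using hf (k - n)⟩

theorem splice_mem_cylinder (x : B.Path) (n : ℕ) (f : ℕ → B.Edge) (h0 : src (f 0) = vertex x n)
    (hf : ∀ k, rng (f k) = src (f (k + 1))) : splice x n f h0 hf ∈ cylinder x n :=
  ⟨rfl, fun k hk => by simp [splice, hk]⟩

theorem splice_apply (x : B.Path) (n : ℕ) (f : ℕ → B.Edge) (h0 : src (f 0) = vertex x n)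
    (hf : ∀ k, rng (f k) = src (f (k + 1))) (k : ℕ) : (splice x n f h0 hf).1.2 (n + k) = f k := by
  simp [splice]

theorem exists_edge_of_pos {v w : Fin B.size} (h : 0 < B.inc v w) :
    ∃ e : B.Edge, src e = w ∧ rng e = v := ⟨⟨(w, v), ⟨0, h⟩⟩, rfl, rfl⟩

theorem inc_pos_of_edge (e : B.Edge) : 0 < B.inc (rng e) (src e) := Fin.pos e.2

theorem inc_vertex_pos (x : B.Path) (n : ℕ) : 0 < B.inc (vertex x (n + 1)) (vertex x n) := by
  rw [← rng_eq_vertex_succ]; exact inc_pos_of_edge _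

theorem exists_edge_seq (v : Fin B.size) :
    ∃ f : ℕ → B.Edge, src (f 0) = v ∧ ∀ k, rng (f k) = src (f (k + 1)) := by
  have h : ∀ w : Fin B.size, ∃ e : B.Edge, src e = w := fun w => by
    obtain ⟨v, hv⟩ := B.exists_out w
    obtain ⟨e, he, -⟩ := exists_edge_of_pos hv
    exact ⟨e, he⟩
  choose out hout using h
  refine ⟨fun n => out ((fun w => rng (out w))^[n] v), hout _, fun k => ?_⟩
  rw [hout, Function.iterate_succ_apply']

/-- A finite path can be prolonged by any edge that starts at its end. -/
theorem exists_mem_cylinder_edge (x : B.Path) (n : ℕ) (e : B.Edge) (he : src e = vertex x n) :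
    ∃ y ∈ cylinder x n, y.1.2 n = e := by
  obtain ⟨f, hf0, hf⟩ := exists_edge_seq (rng e)
  refine ⟨splice x n (fun k => Nat.casesOn k e f) he ?_, splice_mem_cylinder .., ?_⟩
  · rintro (_ | k)
    · exact hf0.symm
    · exact hf k
  · exact splice_apply x n _ _ _ 0

/-- Every vertex lies on a path, at every level. -/
theorem exists_vertex_eq (n : ℕ) (v : Fin B.size) : ∃ x : B.Path, vertex x n = v := by
  induction n generalizing v with
  | zero =>
    obtain ⟨f, hf0, hf⟩ := exists_edge_seq v
    exact ⟨⟨(⟨v, ⟨0, B.top_pos v⟩⟩, f), hf0.symm, hf⟩, hf0⟩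
  | succ n ih =>
    obtain ⟨w, hw⟩ := B.exists_in v
    obtain ⟨x, hx⟩ := ih w
    obtain ⟨e, he, he'⟩ := exists_edge_of_pos hw
    obtain ⟨y, -, hy⟩ := exists_mem_cylinder_edge x n e (he.trans hx.symm)
    exact ⟨y, by rw [← rng_eq_vertex_succ, hy, he']⟩

instance : Nonempty B.Path := ⟨(exists_vertex_eq 0 ⟨0, B.size_pos⟩).choose⟩

/-- If an edge leads from the vertex of `x` at level `n + 1` to the vertex of `y` at the next level,
then some path in the cylinder of `x` is tail equivalent to `y`. -/
theorem exists_mem_cylinder_tailEquiv (x y : B.Path) (n : ℕ)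
    (h : 0 < B.inc (vertex y (n + 1)) (vertex x n)) : ∃ z ∈ cylinder x n, TailEquiv y z := by
  obtain ⟨e, he, he'⟩ := exists_edge_of_pos h
  refine ⟨splice x n (fun k => Nat.casesOn k e fun k => y.1.2 (n + 1 + k)) he ?_,
    splice_mem_cylinder .., n + 1, fun k hk => ?_⟩
  · rintro (_ | k)
    · exact he'
    · exact y.2.2 _
  · obtain ⟨j, rfl⟩ := Nat.exists_eq_add_of_le hk
    rw [add_assoc, splice_apply x n _ _ _ (1 + j), add_comm 1 j, ← add_assoc, add_right_comm]

theorem exists_mem_cylinder_tailEquiv_of_vertex_eq (x y : B.Path) (n : ℕ)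
    (h : vertex y n = vertex x n) : ∃ z ∈ cylinder x n, TailEquiv y z := by
  refine ⟨splice x n (fun k => y.1.2 (n + k)) h fun k => y.2.2 _,
    splice_mem_cylinder .., n, fun k hk => ?_⟩
  obtain ⟨j, rfl⟩ := Nat.exists_eq_add_of_le hk
  exact (splice_apply x n (fun k => y.1.2 (n + k)) h _ j).symm

theorem TailEquiv.symm {x y : B.Path} : TailEquiv x y → TailEquiv y x :=
  fun ⟨N, h⟩ => ⟨N, fun n hn => (h n hn).symm⟩

theorem TailEquiv.exists_vertex_eq {x y : B.Path} : TailEquiv x y →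
    ∃ N, ∀ n, N ≤ n → vertex x n = vertex y n :=
  fun ⟨N, h⟩ => ⟨N, fun n hn => congrArg src (h n hn)⟩

end Paths

section Topology

instance : CompactSpace B.Path := by
  have h1 : IsClosed {x : B.TopEdge × (ℕ → B.Edge) | x.1.1 = src (x.2 0)} :=
    isClosed_eq ((continuous_of_discreteTopology (f := fun e : B.TopEdge => e.1)).comp
      continuous_fst) ((continuous_of_discreteTopology (f := src)).comp
      ((continuous_apply (A := fun _ : ℕ => B.Edge) 0).comp continuous_snd))
  have h2 : ∀ n, IsClosed {x : B.TopEdge × (ℕ → B.Edge) | rng (x.2 n) = src (x.2 (n + 1))} :=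
    fun n => isClosed_eq ((continuous_of_discreteTopology (f := rng)).comp
      ((continuous_apply (A := fun _ : ℕ => B.Edge) n).comp continuous_snd))
      ((continuous_of_discreteTopology (f := src)).comp
      ((continuous_apply (A := fun _ : ℕ => B.Edge) (n + 1)).comp continuous_snd))
  have h3 : IsClosed {x : B.TopEdge × (ℕ → B.Edge) |
      x.1.1 = src (x.2 0) ∧ ∀ n, rng (x.2 n) = src (x.2 (n + 1))} := by
    convert h1.inter (isClosed_iInter h2) using 1
    ext x
    simp
  exact isCompact_iff_compactSpace.1 h3.isCompact

instance : SecondCountableTopology B.Path :=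
  Topology.IsInducing.subtypeVal.secondCountableTopology

theorem continuous_top : Continuous fun x : B.Path => x.1.1 :=
  continuous_fst.comp continuous_subtype_val

theorem continuous_edge (k : ℕ) : Continuous fun x : B.Path => x.1.2 k :=
  (continuous_apply k).comp (continuous_snd.comp continuous_subtype_val)

theorem continuous_vertex (k : ℕ) : Continuous fun x : B.Path => vertex x k :=
  continuous_of_discreteTopology.comp (continuous_edge k)

theorem isClopen_cylinder (x : B.Path) (n : ℕ) : IsClopen (cylinder x n) := by
  have h1 : IsClopen {y : B.Path | y.1.1 = x.1.1} :=
    (isClopen_discrete {x.1.1}).preimage continuous_top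
  have h2 : ∀ k, IsClopen {y : B.Path | y.1.2 k = x.1.2 k} := fun k =>
    (isClopen_discrete {x.1.2 k}).preimage (continuous_edge k)
  have : cylinder x n = {y | y.1.1 = x.1.1} ∩ ⋂ k ∈ Finset.range n, {y | y.1.2 k = x.1.2 k} := by
    ext y; simp [cylinder]
  rw [this]
  exact h1.inter (isClopen_biInter_finset fun k _ => h2 k)

theorem iInter_cylinder (x : B.Path) : ⋂ n, cylinder x n = {x} := by
  refine Set.eq_singleton_iff_unique_mem.2
    ⟨Set.mem_iInter.2 fun n => mem_cylinder_self x n, fun y hy => ?_⟩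
  have hy := Set.mem_iInter.1 hy
  exact Subtype.ext (Prod.ext (hy 0).1 (funext fun k => (hy (k + 1)).2 k k.lt_succ_self))

theorem exists_cylinder_subset {x : B.Path} {U : Set B.Path} (hU : U ∈ 𝓝 x) :
    ∃ n, cylinder x n ⊆ U := by
  refine exists_subset_nhds_of_compactSpace ?_ (fun n => (isClopen_cylinder x n).1) fun y hy => ?_
  · exact directed_of_isDirected_le fun n m h => cylinder_anti x h
  · rw [iInter_cylinder] at hy
    rwa [Set.mem_singleton_iff.1 hy]

theorem mem_closure_iff_cylinder {A : Set B.Path} {x : B.Path} :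
    x ∈ closure A ↔ ∀ n, ∃ y ∈ cylinder x n, y ∈ A := by
  refine ⟨fun h n => ?_, fun h => mem_closure_iff_nhds.2 fun U hU => ?_⟩
  · exact mem_closure_iff.1 h _ (isClopen_cylinder x n).2 (mem_cylinder_self x n)
  · obtain ⟨n, hn⟩ := exists_cylinder_subset hU
    obtain ⟨y, hy, hyA⟩ := h n
    exact ⟨y, hn hy, hyA⟩

/-- A hereditary property that holds for small cylinders around every point holds for all
cylinders of large level. -/
theorem eventually_forall_cylinder {P : Set B.Path → Prop} (mono : ∀ s t, s ⊆ t → P t → P s)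
    (h : ∀ x, ∃ n, P (cylinder x n)) : ∃ N, ∀ n, N ≤ n → ∀ x, P (cylinder x n) := by
  choose n hn using h
  obtain ⟨t, -, ht⟩ := isCompact_univ.elim_nhds_subcover (fun x => cylinder x (n x))
    (fun x _ => (isClopen_cylinder x (n x)).2.mem_nhds (mem_cylinder_self x _))
  refine ⟨t.sup n, fun m hm x => ?_⟩
  obtain ⟨y, hyt, hxy⟩ := Set.mem_iUnion₂.1 (ht (Set.mem_univ x))
  refine mono _ _ ?_ (hn y)
  rw [← cylinder_eq_of_mem hxy]
  exact cylinder_anti x ((Finset.le_sup hyt).trans hm)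

end Topology

/-! ### Counting the cylinders in a clopen set -/

section Counting

/-- The set `V` is the disjoint union of cylinders of level `n`, represented by paths, of which
`c v` end at the vertex `v`. -/
def HasCount (n : ℕ) (V : Set B.Path) (c : Fin B.size → ℕ) : Prop :=
  ∃ F : Finset B.Path, (∀ x ∈ F, ∀ y ∈ F, y ∈ cylinder x n → y = x) ∧
    V = ⋃ x ∈ F, cylinder x n ∧ ∀ v, (F.filter fun x => vertex x n = v).card = c v

theorem HasCount.isClopen {n : ℕ} {V : Set B.Path} {c : Fin B.size → ℕ} (h : HasCount n V c) :
    IsClopen V := by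
  obtain ⟨F, -, rfl, -⟩ := h
  exact isClopen_biUnion_finset fun x _ => isClopen_cylinder x n

theorem hasCount_cylinder (x : B.Path) (n : ℕ) :
    HasCount n (cylinder x n) (Pi.single (vertex x n) 1) := by
  refine ⟨{x}, by simp, by simp, fun v => ?_⟩
  by_cases h : vertex x n = v
  · subst h; simp [Finset.filter_singleton]
  · simp [Finset.filter_singleton, h, Ne.symm h]

theorem exists_hasCount {V : Set B.Path} (hV : IsClopen V) :
    ∃ N, ∀ n, N ≤ n → ∃ c, HasCount n V c := by
  obtain ⟨N, hN⟩ := eventually_forall_cylinder (P := fun s : Set B.Path => s ⊆ V ∨ s ⊆ Vᶜ)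
    (fun s t hst h => h.imp hst.trans hst.trans) (fun x => by
      by_cases hx : x ∈ V
      · exact (exists_cylinder_subset (hV.2.mem_nhds hx)).imp fun n hn => Or.inl hn
      · exact (exists_cylinder_subset (hV.compl.2.mem_nhds hx)).imp fun n hn => Or.inr hn)
  refine ⟨N, fun n hn => ?_⟩
  let π : B.Path → B.TopEdge × (Fin n → B.Edge) := fun x => (x.1.1, fun k => x.1.2 k)
  have hπ : ∀ x y, π y = π x ↔ y ∈ cylinder x n := fun x y => by
    simp only [π, Prod.mk.injEq, funext_iff, Fin.forall_iff]
    rfl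
  obtain ⟨s, hsV, hs⟩ := Set.exists_subset_bijOn V π
  have hfin : s.Finite := hs.finite_iff_finite.2 (Set.toFinite _)
  refine ⟨_, hfin.toFinset, fun x hx y hy hxy => ?_, ?_, fun v => rfl⟩
  · exact hs.injOn (hfin.mem_toFinset.1 hy) (hfin.mem_toFinset.1 hx) ((hπ x y).2 hxy)
  · ext z
    simp only [Set.Finite.mem_toFinset, Set.mem_iUnion, exists_prop]
    constructor
    · intro hz
      obtain ⟨x, hx, hxz⟩ := hs.surjOn ⟨z, hz, rfl⟩
      exact ⟨x, hx, (hπ x z).1 hxz.symm⟩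
    · rintro ⟨x, hx, hz⟩
      refine ((hN n hn x).resolve_right fun h => ?_) hz
      exact h (mem_cylinder_self x n) (hsV hx)

theorem card_filter_edge (v w : Fin B.size) :
    (Finset.univ.filter fun e : B.Edge => src e = w ∧ rng e = v).card = B.inc v w := by
  classical
  rw [← Fintype.card_fin (B.inc v w), ← Finset.card_univ]
  symm
  refine Finset.card_bij (fun i _ => (⟨(w, v), i⟩ : B.Edge))
    (fun i _ => Finset.mem_filter.2 ⟨Finset.mem_univ _, rfl, rfl⟩)
    (fun i _ j _ h => by simpa using h) ?_
  rintro ⟨⟨a, b⟩, i⟩ h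
  obtain ⟨-, h1, h2⟩ := Finset.mem_filter.1 h
  obtain rfl : a = w := h1
  obtain rfl : b = v := h2
  exact ⟨i, Finset.mem_univ _, rfl⟩

/-- Passing to the next level multiplies the vector of counts by the incidence matrix. -/
theorem HasCount.succ {n : ℕ} {V : Set B.Path} {c : Fin B.size → ℕ} (h : HasCount n V c) :
    HasCount (n + 1) V (B.inc.mulVec c) := by
  classical
  obtain ⟨F, hF, rfl, hc⟩ := h
  have ext : ∀ (x : B.Path) (e : B.Edge), ∃ y : B.Path, src e = vertex x n →
      y ∈ cylinder x n ∧ y.1.2 n = e := fun x e => by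
    by_cases he : src e = vertex x n
    · obtain ⟨y, hy, hye⟩ := exists_mem_cylinder_edge x n e he
      exact ⟨y, fun _ => ⟨hy, hye⟩⟩
    · exact ⟨x, fun h => (he h).elim⟩
  choose ext hext using ext
  let S : Finset (Σ _ : B.Path, B.Edge) :=
    F.sigma fun x => Finset.univ.filter fun e => src e = vertex x n
  have hS : ∀ p, p ∈ S ↔ p.1 ∈ F ∧ src p.2 = vertex p.1 n := fun p => by simp [S]
  -- two prolongations in the same cylinder coincide
  have hinj : ∀ p ∈ S, ∀ r ∈ S, ext r.1 r.2 ∈ cylinder (ext p.1 p.2) (n + 1) → r = p := by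
    rintro ⟨x, e⟩ hp ⟨y, f⟩ hr hmem
    obtain ⟨hx, he⟩ := (hS _).1 hp
    obtain ⟨hy, hf⟩ := (hS _).1 hr
    obtain ⟨hx1, hx2⟩ := hext x e he
    obtain ⟨hy1, hy2⟩ := hext y f hf
    have h1 : f = e := by rw [← hx2, ← hy2]; exact hmem.2 n n.lt_succ_self
    have h2 : y ∈ cylinder x n := by
      rw [← cylinder_eq_of_mem hx1, ← cylinder_eq_of_mem (cylinder_anti _ n.le_succ hmem),
        cylinder_eq_of_mem hy1]
      exact mem_cylinder_self y n
    have h3 := hF x hx y hy h2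
    subst h1 h3
    rfl
  refine ⟨S.image fun p => ext p.1 p.2, ?_, ?_, fun v => ?_⟩
  · simp only [Finset.forall_mem_image]
    exact fun p hp r hr hmem => by rw [hinj p hp r hr hmem]
  · ext z
    simp only [Set.mem_iUnion, Finset.mem_image, exists_prop, exists_exists_and_eq_and]
    constructor
    · rintro ⟨x, hx, hz⟩
      have hz' : src (z.1.2 n) = vertex x n := vertex_eq_of_mem_cylinder hz le_rfl
      obtain ⟨h1, h2⟩ := hext x (z.1.2 n) hz'
      refine ⟨⟨x, z.1.2 n⟩, (hS _).2 ⟨hx, hz'⟩, hz.1.trans h1.1.symm, fun k hk => ?_⟩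
      rcases Nat.lt_succ_iff_lt_or_eq.1 hk with hk | rfl
      · exact (hz.2 k hk).trans (h1.2 k hk).symm
      · exact h2.symm
    · rintro ⟨⟨x, e⟩, hp, hz⟩
      obtain ⟨hx, he⟩ := (hS _).1 hp
      refine ⟨x, hx, ?_⟩
      rw [← cylinder_eq_of_mem (hext x e he).1]
      exact cylinder_anti _ n.le_succ hz
  · rw [Finset.filter_image, Finset.card_image_of_injOn]
    swap
    · intro p hp r hr h
      refine (hinj p (Finset.mem_filter.1 hp).1 r (Finset.mem_filter.1 hr).1 ?_).symm
      rw [← show ext p.1 p.2 = ext r.1 r.2 from h]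
      exact mem_cylinder_self _ _
    have h1 : S.filter (fun p => vertex (ext p.1 p.2) (n + 1) = v) =
        F.sigma fun x => Finset.univ.filter fun e => src e = vertex x n ∧ rng e = v := by
      ext ⟨x, e⟩
      simp only [Finset.mem_filter, hS, Finset.mem_sigma, Finset.mem_univ, true_and, and_assoc]
      refine and_congr_right fun hx => and_congr_right fun he => ?_
      rw [← rng_eq_vertex_succ, (hext x e he).2]
    rw [h1, Finset.card_sigma, Matrix.mulVec, dotProduct]
    simp only [card_filter_edge]
    rw [← Finset.sum_fiberwise F (fun x => vertex x n)]
    refine Finset.sum_congr rfl fun w _ => ?_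
    rw [← hc w, Finset.sum_congr rfl fun x hx => by rw [(Finset.mem_filter.1 hx).2],
      Finset.sum_const, smul_eq_mul, mul_comm]

theorem HasCount.exists_subset {n : ℕ} {V : Set B.Path} {c d : Fin B.size → ℕ}
    (h : HasCount n V c) (hd : d ≤ c) : ∃ W ⊆ V, HasCount n W d := by
  classical
  obtain ⟨F, hF, rfl, hc⟩ := h
  have : ∀ v, ∃ G ⊆ F.filter (fun x => vertex x n = v), G.card = d v := fun v =>
    Finset.exists_subset_card_eq ((hd v).trans (hc v).ge)
  choose G hG hGc using this
  have hsub : Finset.univ.biUnion G ⊆ F := by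
    refine Finset.biUnion_subset.2 fun v _ => (hG v).trans (Finset.filter_subset _ _)
  refine ⟨⋃ x ∈ Finset.univ.biUnion G, cylinder x n, ?_, Finset.univ.biUnion G,
    fun x hx y hy => hF x (hsub hx) y (hsub hy), rfl, fun v => ?_⟩
  · exact Set.biUnion_subset_biUnion_left hsub
  · rw [← hGc v]
    congr 1
    ext x
    simp only [Finset.mem_filter, Finset.mem_biUnion, Finset.mem_univ, true_and]
    constructor
    · rintro ⟨⟨w, hw⟩, hx⟩
      have := (Finset.mem_filter.1 (hG w hw)).2
      rw [← hx, this]; exact hw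
    · exact fun hx => ⟨⟨v, hx⟩, (Finset.mem_filter.1 (hG v hx)).2⟩

theorem HasCount.measureReal_eq {μ : Measure B.Path} [IsFiniteMeasure μ] {n : ℕ} {V : Set B.Path}
    {c : Fin B.size → ℕ} (h : HasCount n V c) {p : Fin B.size → ℝ}
    (hp : ∀ x, μ.real (cylinder x n) = p (vertex x n)) : μ.real V = ∑ v, (c v : ℝ) * p v := by
  classical
  obtain ⟨F, hF, rfl, hc⟩ := h
  rw [measureReal_biUnion_finset (fun x hx y hy hxy => disjoint_cylinder_of_notMem
    fun h' => hxy (hF x hx y hy h').symm) fun x _ => (isClopen_cylinder x n).2.measurableSet,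
    ← Finset.sum_fiberwise F (fun x => vertex x n)]
  refine Finset.sum_congr rfl fun v _ => ?_
  rw [← hc v, Finset.sum_congr rfl fun x hx => by rw [hp, (Finset.mem_filter.1 hx).2],
    Finset.sum_const, nsmul_eq_mul]

/-- A finite measure on the path space is determined by the cylinders of large level. -/
theorem measure_ext_of_cylinder {μ ν : Measure B.Path} [IsFiniteMeasure μ] [IsFiniteMeasure ν]
    (N : ℕ) (h : ∀ n, N ≤ n → ∀ x : B.Path, μ (cylinder x n) = ν (cylinder x n)) : μ = ν := by
  have key : ∀ V : Set B.Path, IsClopen V → μ V = ν V := fun V hV => by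
    obtain ⟨m, hm⟩ := exists_hasCount hV
    obtain ⟨c, F, hF, rfl, -⟩ := hm (max m N) (le_max_left _ _)
    have hd : (F : Set B.Path).PairwiseDisjoint fun x => cylinder x (max m N) :=
      fun x hx y hy hxy => disjoint_cylinder_of_notMem fun h' => hxy (hF x hx y hy h').symm
    rw [measure_biUnion_finset hd fun x _ => (isClopen_cylinder x _).2.measurableSet,
      measure_biUnion_finset hd fun x _ => (isClopen_cylinder x _).2.measurableSet]
    exact Finset.sum_congr rfl fun x _ => h _ (le_max_right _ _) x
  exact ext_of_generate_finite _ borel_eq_generateFrom_isClopen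
    (fun s hs t ht _ => IsClopen.inter hs ht) key (key _ isClopen_univ)

end Counting

/-! ### Invariant measures -/

section Invariant

/-- The mass that an invariant measure gives to the cylinders of level `n` at the vertex `v`. It is
read off from one cylinder, chosen arbitrarily. -/
noncomputable def mass (μ : Measure B.Path) (n : ℕ) (v : Fin B.size) : ℝ :=
  μ.real (cylinder (exists_vertex_eq n v).choose n)

theorem IsInvariant.measureReal_cylinder {μ : Measure B.Path} (h : IsInvariant μ) (x : B.Path)
    (n : ℕ) : μ.real (cylinder x n) = mass μ n (vertex x n) :=
  congrArg ENNReal.toReal (h n _ _ (exists_vertex_eq n (vertex x n)).choose_spec.symm)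

theorem mass_nonneg (μ : Measure B.Path) (n : ℕ) (v : Fin B.size) : 0 ≤ mass μ n v :=
  measureReal_nonneg

theorem isHarmonic_of_cylinder {μ : Measure B.Path} [IsFiniteMeasure μ]
    {p : ℕ → Fin B.size → ℝ} (h : ∀ n x, μ.real (cylinder x n) = p n (vertex x n)) :
    IsHarmonic B.inc p := by
  classical
  intro n w
  obtain ⟨x, rfl⟩ := exists_vertex_eq n w
  rw [← h, (hasCount_cylinder x n).succ.measureReal_eq (h (n + 1))]
  simp

/-- Tail equivalence maps one cylinder to another with the same end: in the paths of the cylinder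
of `x`, the initial segment is replaced by that of `y`. All other paths are left fixed. -/
noncomputable def transplant (x y : B.Path) (n : ℕ) (h : vertex x n = vertex y n) (z : B.Path) :
    B.Path :=
  open Classical in
  ⟨(if z ∈ cylinder x n then y.1.1 else z.1.1,
    fun k => if z ∈ cylinder x n ∧ k < n then y.1.2 k else z.1.2 k), by
    by_cases hz : z ∈ cylinder x n
    · have hv : vertex z n = vertex y n := (vertex_eq_of_mem_cylinder hz le_rfl).trans h
      simp only [hz, if_true, true_and]
      constructor
      · rcases Nat.eq_zero_or_pos n with rfl | hn
        · exact (top_fst_eq_vertex y).trans hv.symm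
        · simpa [hn] using y.2.1
      · intro k
        rcases lt_trichotomy (k + 1) n with hk | hk | hk
        · simpa [hk, (Nat.lt_succ_self k).trans hk] using y.2.2 k
        · subst hk
          simpa using! (rng_eq_vertex_succ y k).trans hv.symm
        · have h1 : ¬ k < n := by omega
          have h2 : ¬ k + 1 < n := by omega
          simpa [h1, h2] using z.2.2 k
    · simpa [hz] using z.2⟩

theorem transplant_mem {x y : B.Path} {n : ℕ} (h : vertex x n = vertex y n) {z : B.Path}
    (hz : z ∈ cylinder x n) : transplant x y n h z ∈ cylinder y n :=
  ⟨by simp [transplant, hz], fun k hk => by simp [transplant, hz, hk]⟩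

theorem transplant_apply {x y : B.Path} {n : ℕ} (h : vertex x n = vertex y n) (z : B.Path) {k : ℕ}
    (hk : n ≤ k) : (transplant x y n h z).1.2 k = z.1.2 k := by
  simp [transplant, hk.not_gt]

theorem continuous_transplant {x y : B.Path} {n : ℕ} (h : vertex x n = vertex y n) :
    Continuous (transplant x y n h) := by
  classical
  have hc : ∀ {α : Type} [TopologicalSpace α] (f g : B.Path → α), Continuous f → Continuous g →
      Continuous fun z => if z ∈ cylinder x n then f z else g z := by
    intro α _ f g hf hg
    refine continuous_if (fun a ha => ?_) hf.continuousOn hg.continuousOn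
    change a ∈ frontier (cylinder x n) at ha
    rw [(isClopen_cylinder x n).frontier_eq] at ha
    exact ha.elim
  refine Continuous.subtype_mk (Continuous.prodMk
    ((hc (fun _ => y.1.1) _ continuous_const continuous_top).congr fun z => ?_)
    (continuous_pi fun k => ?_)) _
  · congr
  · by_cases hk : k < n
    · simpa [hk] using hc (fun _ => y.1.2 k) _ continuous_const (continuous_edge k)
    · simpa [hk] using continuous_edge k

/-- Invariance passes from cylinders to saturated Borel sets. -/
theorem IsInvariant.measure_inter_cylinder {μ : Measure B.Path} [IsFiniteMeasure μ]
    (hμ : IsInvariant μ) {A : Set B.Path} (hA : MeasurableSet A) (hsat : IsSaturated A) {n : ℕ}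
    {x y : B.Path} (h : vertex x n = vertex y n) :
    μ (A ∩ cylinder x n) = μ (A ∩ cylinder y n) := by
  have hTm := (continuous_transplant h).measurable
  have hcx := (isClopen_cylinder x n).2.measurableSet
  have hcy := (isClopen_cylinder y n).2.measurableSet
  have key : (μ.restrict (cylinder x n)).map (transplant x y n h) = μ.restrict (cylinder y n) := by
    refine measure_ext_of_cylinder n fun l hl z => ?_
    have hcz := (isClopen_cylinder z l).2.measurableSet
    rw [Measure.map_apply hTm hcz, Measure.restrict_apply (hTm hcz), Measure.restrict_apply hcz]
    by_cases hz : z ∈ cylinder y n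
    · have h1 : cylinder z l ∩ cylinder y n = cylinder z l := by
        rw [Set.inter_eq_left, ← cylinder_eq_of_mem hz]
        exact cylinder_anti z hl
      have h2 : transplant x y n h ⁻¹' cylinder z l ∩ cylinder x n =
          cylinder (transplant y x n h.symm z) l := by
        have hT := transplant_mem h.symm hz
        ext w
        constructor
        · rintro ⟨hw, hwx⟩
          refine ⟨hwx.1.trans hT.1.symm, fun k hk => ?_⟩
          rcases lt_or_ge k n with hkn | hkn
          · rw [hwx.2 k hkn, hT.2 k hkn]
          · rw [transplant_apply h.symm z hkn, ← hw.2 k hk, transplant_apply h w hkn]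
        · intro hw
          have hwx : w ∈ cylinder x n := by
            rw [← cylinder_eq_of_mem hT]; exact cylinder_anti _ hl hw
          have hT' := transplant_mem h hwx
          refine ⟨⟨hT'.1.trans hz.1.symm, fun k hk => ?_⟩, hwx⟩
          rcases lt_or_ge k n with hkn | hkn
          · rw [hT'.2 k hkn, hz.2 k hkn]
          · rw [transplant_apply h w hkn, hw.2 k hk, transplant_apply h.symm z hkn]
      rw [h1, h2]
      exact hμ l _ _ (congrArg src (transplant_apply h.symm z hl))
    · have hdis : Disjoint (cylinder y n) (cylinder z n) := disjoint_cylinder_of_notMem hz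
      have h1 : cylinder z l ∩ cylinder y n = ∅ := by
        rw [← Set.disjoint_iff_inter_eq_empty]
        exact (hdis.mono_right (cylinder_anti z hl)).symm
      have h2 : transplant x y n h ⁻¹' cylinder z l ∩ cylinder x n = ∅ := by
        refine Set.eq_empty_of_forall_notMem fun w hw => ?_
        exact Set.disjoint_left.1 hdis (transplant_mem h hw.2) (cylinder_anti z hl hw.1)
      rw [h1, h2]
  have := congrArg (fun m => m A) key
  simp only [Measure.map_apply hTm hA, Measure.restrict_apply (hTm hA),
    Measure.restrict_apply hA] at this
  rw [← this]
  congr 1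
  ext w
  refine and_congr_left fun _ => ?_
  have ht : TailEquiv w (transplant x y n h w) := ⟨n, fun k hk => (transplant_apply h w hk).symm⟩
  exact ⟨hsat _ _ ht, hsat _ _ ht.symm⟩

end Invariant

end StationaryBratteli

/-! ### Invariant measures with prescribed masses -/

instance {ι : Type*} {β : ι → Type*} [∀ i, MeasurableSpace (β i)]
    [∀ i, DiscreteMeasurableSpace (β i)] : DiscreteMeasurableSpace (Σ i, β i) :=
  ⟨fun s => MeasurableSpace.measurableSet_iInf.2 fun i =>
    (.of_discrete : MeasurableSet (Sigma.mk i ⁻¹' s))⟩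

namespace StationaryBratteli

variable {B : StationaryBratteli}

/-- The edges that start at the vertex `v`. -/
abbrev OutEdge (B : StationaryBratteli) (v : Fin B.size) : Type := {e : B.Edge // src e = v}

theorem sum_outEdge (v : Fin B.size) (f : Fin B.size → ℝ) :
    ∑ e : B.OutEdge v, f (rng e.1) = ∑ u, (B.inc u v : ℝ) * f u := by
  classical
  rw [← Finset.sum_subtype (Finset.univ.filter fun e : B.Edge => src e = v) (by simp)
    (fun e => f (rng e)), ← Finset.sum_fiberwise _ rng]
  refine Finset.sum_congr rfl fun u _ => ?_
  rw [Finset.filter_filter, Finset.sum_congr rfl fun e he => by rw [(Finset.mem_filter.1 he).2.2],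
    Finset.sum_const, card_filter_edge, nsmul_eq_mul]

/-- The vertices met when at every level the outgoing edge chosen by `ω` is followed. -/
def followVertex (t : B.TopEdge) (ω : ∀ i : ℕ × Fin B.size, B.OutEdge i.2) : ℕ → Fin B.size
  | 0 => t.1
  | n + 1 => rng (ω (n, followVertex t ω n)).1

/-- The path that starts with `t` and follows the outgoing edges chosen by `ω`. -/
def followPath (p : B.TopEdge × ∀ i : ℕ × Fin B.size, B.OutEdge i.2) : B.Path :=
  ⟨(p.1, fun n => (p.2 (n, followVertex p.1 p.2 n)).1),
    (p.2 (0, followVertex p.1 p.2 0)).2.symm,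
    fun n => (p.2 (n + 1, followVertex p.1 p.2 (n + 1))).2.symm⟩

theorem vertex_followPath (p : B.TopEdge × ∀ i : ℕ × Fin B.size, B.OutEdge i.2) (n : ℕ) :
    vertex (followPath p) n = followVertex p.1 p.2 n :=
  (p.2 (n, followVertex p.1 p.2 n)).2

/-- A path lies in a given cylinder iff finitely many independent choices are prescribed. -/
theorem followPath_preimage_cylinder (x : B.Path) (n : ℕ) :
    followPath ⁻¹' cylinder x n = {x.1.1} ×ˢ
      Set.pi ((Finset.range n).image fun k => (k, vertex x k)) fun i => {o | o.1 = x.1.2 i.1} := by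
  ext ⟨t, ω⟩
  simp only [Set.mem_preimage, Set.mem_prod, Set.mem_singleton_iff, Set.mem_pi, Finset.coe_image,
    Set.mem_image, Finset.coe_range, Set.mem_Iio, forall_exists_index, and_imp,
    forall_apply_eq_imp_iff₂]
  constructor
  · intro h
    refine ⟨h.1, fun k hk => ?_⟩
    have hv : followVertex t ω k = vertex x k := by
      rw [← vertex_followPath (t, ω)]; exact vertex_eq_of_mem_cylinder h hk.le
    rw [← hv]
    exact h.2 k hk
  · rintro ⟨ht, h⟩
    have hv : ∀ k, k ≤ n → followVertex t ω k = vertex x k := by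
      intro k
      induction k with
      | zero => exact fun _ => (congrArg Sigma.fst ht).trans (top_fst_eq_vertex x)
      | succ k ih =>
        intro hk
        rw [followVertex, ih (by omega), h k hk, rng_eq_vertex_succ]
    refine ⟨ht, fun k hk => ?_⟩
    change (ω (k, followVertex t ω k)).1 = _
    rw [hv k hk.le]
    exact h k hk

/-- A positive normalised harmonic sequence is the sequence of cylinder masses of a probability
measure: the outgoing edges at all vertices are chosen independently. -/
theorem exists_measure_of_isHarmonic {p : ℕ → Fin B.size → ℝ} (hp : ∀ n v, 0 < p n v)
    (hharm : IsHarmonic B.inc p) (htop : ∑ v, (B.top v : ℝ) * p 0 v = 1) :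
    ∃ ν : Measure B.Path, IsProbabilityMeasure ν ∧
      ∀ n x, ν.real (cylinder x n) = p n (vertex x n) := by
  classical
  have hsum : ∀ i : ℕ × Fin B.size, ∑ e : B.OutEdge i.2,
      ENNReal.ofReal (p (i.1 + 1) (rng e.1) / p i.1 i.2) = 1 := by
    intro i
    rw [← ENNReal.ofReal_sum_of_nonneg fun e _ => div_nonneg (hp _ _).le (hp _ _).le,
      ← Finset.sum_div, sum_outEdge, ← hharm i.1 i.2, div_self (hp _ _).ne', ENNReal.ofReal_one]
  have hsum0 : ∑ t : B.TopEdge, ENNReal.ofReal (p 0 t.1) = 1 := by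
    rw [← ENNReal.ofReal_sum_of_nonneg fun e _ => (hp _ _).le, Fintype.sum_sigma]
    simp [htop]
  let m0 : Measure B.TopEdge := (PMF.ofFintype _ hsum0).toMeasure
  let m : ∀ i : ℕ × Fin B.size, Measure (B.OutEdge i.2) :=
    fun i => (PMF.ofFintype _ (hsum i)).toMeasure
  have hmeas : Measurable (followPath (B := B)) := by
    rw [borel_eq_generateFrom_isClopen (X := B.Path)]
    refine measurable_generateFrom fun V hV => ?_
    obtain ⟨N, hN⟩ := exists_hasCount hV
    obtain ⟨c, F, -, rfl, -⟩ := hN N le_rfl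
    simp only [Set.preimage_iUnion]
    refine Finset.measurableSet_biUnion _ fun x _ => ?_
    rw [followPath_preimage_cylinder]
    exact (MeasurableSet.of_discrete).prod
      (MeasurableSet.pi (Set.to_countable _) fun _ _ => MeasurableSet.of_discrete)
  have hprob : IsProbabilityMeasure ((m0.prod (Measure.infinitePi m)).map followPath) :=
    Measure.isProbabilityMeasure_map hmeas.aemeasurable
  refine ⟨(m0.prod (Measure.infinitePi m)).map followPath, hprob, fun n x => ?_⟩
  have hm : ∀ k, m (k, vertex x k) {o | o.1 = x.1.2 k} =
      ENNReal.ofReal (p (k + 1) (vertex x (k + 1)) / p k (vertex x k)) := by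
    intro k
    have : {o : B.OutEdge (vertex x k) | o.1 = x.1.2 k} = {⟨x.1.2 k, rfl⟩} := by
      ext o; simp [Subtype.ext_iff]
    change m (k, vertex x k) {o : B.OutEdge (vertex x k) | o.1 = x.1.2 k} = _
    rw [this, PMF.toMeasure_apply_singleton _ _ MeasurableSet.of_discrete, PMF.ofFintype_apply,
      rng_eq_vertex_succ]
  have htel : ∏ k ∈ Finset.range n, p (k + 1) (vertex x (k + 1)) / p k (vertex x k) =
      p n (vertex x n) / p 0 (vertex x 0) := by
    induction n with
    | zero => simp [(hp _ _).ne']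
    | succ n ih =>
      rw [Finset.prod_range_succ, ih, mul_comm, div_mul_div_cancel₀ (hp _ _).ne']
  rw [measureReal_def, Measure.map_apply hmeas (isClopen_cylinder x n).2.measurableSet,
    followPath_preimage_cylinder, Measure.prod_prod, Measure.infinitePi_pi m
      (fun _ _ => MeasurableSet.of_discrete),
    Finset.prod_image (fun a _ b _ h => congrArg Prod.fst h)]
  simp only [hm]
  rw [PMF.toMeasure_apply_singleton _ _ MeasurableSet.of_discrete, PMF.ofFintype_apply,
    top_fst_eq_vertex, ← ENNReal.ofReal_prod_of_nonneg
      (fun k _ => div_nonneg (hp _ _).le (hp _ _).le),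
    htel, ← ENNReal.ofReal_mul (hp _ _).le,
    ENNReal.toReal_ofReal (mul_nonneg (hp _ _).le (div_nonneg (hp _ _).le (hp _ _).le)),
    mul_div_cancel₀ _ (hp _ _).ne']

end StationaryBratteli

/-! ### The value group of a harmonic sequence -/

section ValueGroup

open Matrix

variable {E : Type*} [Fintype E] {M : Matrix E E ℕ} {q : ℕ → E → ℝ}

/-- Integer vectors stay integer under a nonnegative integer matrix. -/
theorem exists_int_iterate_pushVec (M : Matrix E E ℕ) (a : E → ℤ) (j : ℕ) :
    ∃ b : E → ℤ, (fun v => (b v : ℝ)) = (pushVec M)^[j] fun v => (a v : ℝ) := by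
  induction j with
  | zero => exact ⟨a, rfl⟩
  | succ j ih =>
    obtain ⟨b, hb⟩ := ih
    refine ⟨fun v => ∑ w, (M v w : ℤ) * b w, ?_⟩
    rw [Function.iterate_succ_apply', ← hb]
    ext v
    simp [pushVec]

theorem IsHarmonic.exists_int_rep (h : IsHarmonic M q) {n n' : ℕ} (hn : n ≤ n') (a : E → ℤ) :
    ∃ b : E → ℤ, ∑ v, (b v : ℝ) * q n' v = ∑ v, (a v : ℝ) * q n v := by
  obtain ⟨j, rfl⟩ := Nat.exists_eq_add_of_le hn
  obtain ⟨b, hb⟩ := exists_int_iterate_pushVec M a j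
  refine ⟨b, ?_⟩
  have := h.sum_mul_iterate n j fun v => (a v : ℝ)
  rw [← hb] at this
  simpa only [mul_comm] using this

/-- The group of integer combinations of the entries of a harmonic sequence. -/
def IsHarmonic.valueGroup (h : IsHarmonic M q) : AddSubgroup ℝ where
  carrier := {g | ∃ n, ∃ a : E → ℤ, g = ∑ v, (a v : ℝ) * q n v}
  zero_mem' := ⟨0, 0, by simp⟩
  add_mem' := by
    rintro _ _ ⟨n, a, rfl⟩ ⟨n', a', rfl⟩
    obtain ⟨b, hb⟩ := h.exists_int_rep (le_max_left n n') a
    obtain ⟨b', hb'⟩ := h.exists_int_rep (le_max_right n n') a'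
    refine ⟨max n n', b + b', ?_⟩
    simp [add_mul, Finset.sum_add_distrib, hb, hb']
  neg_mem' := by
    rintro _ ⟨n, a, rfl⟩
    exact ⟨n, -a, by simp⟩

/-- Positive elements of the value group are combinations with positive integer coefficients. -/
theorem IsHarmonic.exists_nat_rep (h : IsHarmonic M q) (hq : ∀ n v, 0 < q n v)
    (hM : ∀ v w, 1 ≤ M v w) {g : ℝ} (hg : g ∈ h.valueGroup) (hpos : 0 < g) :
    ∃ n, ∃ a : E → ℕ, (∀ v, 0 < a v) ∧ g = ∑ v, (a v : ℝ) * q n v := by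
  obtain ⟨n, b, rfl⟩ := hg
  obtain ⟨j, hj⟩ := h.exists_iterate_pos hq hM n (fun v => (b v : ℝ))
    (by simpa only [mul_comm] using hpos)
  have hs := h.sum_mul_iterate n j fun v => (b v : ℝ)
  obtain ⟨c, hc⟩ := exists_int_iterate_pushVec M b j
  rw [← hc] at hs hj
  have hc0 : ∀ v, 0 < c v := fun v => Int.cast_pos.1 (hj v)
  refine ⟨n + j, fun v => (c v).toNat,
    fun v => Int.lt_toNat.2 (hc0 v), ?_⟩
  have hcast : ∀ v, (((c v).toNat : ℕ) : ℝ) = c v := fun v => by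
    exact_mod_cast Int.toNat_of_nonneg (hc0 v).le
  simp only [hcast]
  simpa only [mul_comm] using hs.symm

theorem IsHarmonic.pow [DecidableEq E] (h : IsHarmonic M q) (n j : ℕ) (w : E) :
    q n w = ∑ v, ((M ^ j) v w : ℝ) * q (n + j) v := by
  induction j generalizing w with
  | zero => simp [Matrix.one_apply]
  | succ j ih =>
    rw [ih w]
    simp only [pow_succ', Matrix.mul_apply, Nat.cast_sum, Nat.cast_mul, Finset.sum_mul]
    rw [Finset.sum_comm]
    refine Finset.sum_congr rfl fun u _ => ?_
    rw [h (n + j) u, Finset.mul_sum]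
    refine Finset.sum_congr rfl fun v _ => ?_
    rw [← add_assoc]
    ring

theorem IsHarmonic.telescope [DecidableEq E] (h : IsHarmonic M q) (j : ℕ) :
    IsHarmonic (M ^ j) fun n => q (j * n) := fun n w => h.pow (j * n) j w

theorem IsHarmonic.valueGroup_telescope [DecidableEq E] (h : IsHarmonic M q) {j : ℕ} (hj : 0 < j) :
    (h.telescope j).valueGroup = h.valueGroup := by
  ext g
  constructor
  · rintro ⟨n, a, ha⟩
    exact ⟨j * n, a, ha⟩
  · rintro ⟨n, a, rfl⟩
    obtain ⟨b, hb⟩ := h.exists_int_rep (Nat.le_mul_of_pos_left n hj) a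
    exact ⟨n, b, hb.symm⟩

/-- If a positive harmonic sequence tends to zero, some power of the matrix has large entries. -/
theorem IsHarmonic.exists_pow_ge [DecidableEq E] [Nonempty E] (h : IsHarmonic M q)
    (hq : ∀ n v, 0 < q n v) (hM : ∀ v w, 1 ≤ M v w)
    (hlim : ∀ v, Filter.Tendsto (fun n => q n v) Filter.atTop (𝓝 0)) (K : ℕ) :
    ∃ j, 0 < j ∧ ∀ v w, K ≤ (M ^ j) v w := by
  obtain ⟨w⟩ := ‹Nonempty E›
  obtain ⟨j, v', w', hj⟩ : ∃ j v' w', K ≤ (M ^ j) v' w' := by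
    by_contra! hcon
    have hle : ∀ j, q 0 w ≤ ∑ v, (K : ℝ) * q j v := by
      intro j
      rw [h.pow 0 j w, zero_add]
      exact Finset.sum_le_sum fun v _ => mul_le_mul_of_nonneg_right
        (by exact_mod_cast (hcon j v w).le) (hq _ _).le
    have hl : Filter.Tendsto (fun j => ∑ v, (K : ℝ) * q j v) Filter.atTop
        (𝓝 (∑ _v : E, (K : ℝ) * 0)) :=
      tendsto_finsetSum _ fun v _ => (hlim v).const_mul _
    have := ge_of_tendsto' hl hle
    simp only [mul_zero, Finset.sum_const_zero] at this
    exact absurd (hq 0 w) this.not_gt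
  refine ⟨j + 2, by omega, fun v w => ?_⟩
  have h1 : M ^ (j + 2) = M * (M ^ j * M) := by rw [← pow_succ, ← pow_succ']
  rw [h1, Matrix.mul_apply]
  calc K ≤ (M ^ j) v' w' := hj
    _ ≤ (M ^ j) v' w' * M w' w := Nat.le_mul_of_pos_right _ (hM w' w)
    _ ≤ (M ^ j * M) v' w := by
        rw [Matrix.mul_apply]
        exact Finset.single_le_sum (f := fun u => (M ^ j) v' u * M u w) (fun _ _ => Nat.zero_le _)
          (Finset.mem_univ w')
    _ ≤ M v v' * (M ^ j * M) v' w := Nat.le_mul_of_pos_left _ (hM v v')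
    _ ≤ _ := Finset.single_le_sum (f := fun u => M v u * (M ^ j * M) u w)
          (fun _ _ => Nat.zero_le _) (Finset.mem_univ v')

theorem matrix_mul_pos_iff {A C : Matrix E E ℕ} {v w : E} :
    0 < (A * C) v w ↔ ∃ u, 0 < A v u ∧ 0 < C u w := by
  simp [Matrix.mul_apply, Finset.sum_pos_iff]

/-- Some power of a nonnegative matrix has the same zero pattern as all its positive powers. -/
theorem exists_pow_pattern_idempotent [DecidableEq E] (A : Matrix E E ℕ) :
    ∃ k, 0 < k ∧ ∀ j, 0 < j → ∀ v w, 0 < (A ^ (k * j)) v w ↔ 0 < (A ^ k) v w := by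
  classical
  obtain ⟨a, b, hab, h⟩ := Finite.exists_ne_map_eq_of_infinite
    fun (n : ℕ) (v w : E) => decide (0 < (A ^ (n + 1)) v w)
  wlog hlt : a < b generalizing a b
  · exact this b a hab.symm h.symm (lt_of_le_of_ne (not_lt.1 hlt) hab.symm)
  have h0 : ∀ v w, 0 < (A ^ (a + 1)) v w ↔ 0 < (A ^ (b + 1)) v w := fun v w => by
    simpa using congrFun (congrFun h v) w
  obtain ⟨d, rfl⟩ := Nat.exists_eq_add_of_lt hlt
  -- from the exponent `a + 1` on, the patterns have the period `d + 1`
  have h1 : ∀ n v w, 0 < (A ^ (a + 1 + n)) v w ↔ 0 < (A ^ (a + 1 + n + (d + 1))) v w := by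
    intro n v w
    rw [show a + 1 + n + (d + 1) = (a + d + 1 + 1) + n by ring, pow_add,
      pow_add (m := a + d + 1 + 1), matrix_mul_pos_iff, matrix_mul_pos_iff]
    simp only [h0]
  have h2 : ∀ i n v w, 0 < (A ^ (a + 1 + n)) v w ↔ 0 < (A ^ (a + 1 + n + i * (d + 1))) v w := by
    intro i
    induction i with
    | zero => simp
    | succ i ih =>
      intro n v w
      rw [h1 n v w, add_assoc (a + 1) n, ih]
      ring_nf
  refine ⟨(a + 1) * (d + 1), by positivity, fun j hj v w => ?_⟩
  have e1 : (a + 1) * (d + 1) = a + 1 + (a + 1) * d := by ring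
  obtain ⟨i, rfl⟩ := Nat.exists_eq_add_of_le' hj
  rw [show (a + 1) * (d + 1) * (i + 1) = a + 1 + (a + 1) * d + (i * (a + 1)) * (d + 1) by ring,
    ← h2, e1]

end ValueGroup

/-! ### The support of a measure and clopen sets -/

/-- A clopen subset of the support is the trace of a clopen set. -/
theorem exists_isClopen_preimage_support {X : Type*} [TopologicalSpace X]
    [MeasurableSpace X] [CompactSpace X] [T2Space X] [TotallyDisconnectedSpace X]
    (μ : Measure X) {U : Set μ.support} (hU : IsClopen U) :
    ∃ V : Set X, IsClopen V ∧ Subtype.val ⁻¹' V = U := by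
  obtain ⟨O, hO, hOU⟩ := isOpen_induced_iff.1 hU.2
  have hK : IsCompact (Subtype.val '' U) :=
    ((Measure.isClosed_support.isClosedEmbedding_subtypeVal).isClosedMap _ hU.1).isCompact
  have hKO : Subtype.val '' U ⊆ O := by
    rintro _ ⟨x, hx, rfl⟩
    rw [← hOU] at hx
    exact hx
  have hb := loc_compact_Haus_tot_disc_of_zero_dim (H := X)
  have hex : ∀ x ∈ Subtype.val '' U, ∃ C : Set X, IsClopen C ∧ x ∈ C ∧ C ⊆ O := fun x hx => by
    obtain ⟨C, hC, hxC, hCO⟩ := hb.mem_nhds_iff.1 (hO.mem_nhds (hKO hx))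
    exact ⟨C, hC, hxC, hCO⟩
  choose! C hC hxC hCO using hex
  obtain ⟨t, ht, hcov⟩ := hK.elim_nhds_subcover C fun x hx => (hC x hx).2.mem_nhds (hxC x hx)
  refine ⟨⋃ x ∈ t, C x, t.finite_toSet.isClopen_biUnion fun x hx => hC x (ht x hx), ?_⟩
  ext y
  constructor
  · intro hy
    obtain ⟨x, hx, hyx⟩ := Set.mem_iUnion₂.1 hy
    rw [← hOU]
    exact hCO x (ht x hx) hyx
  · exact fun hy => hcov ⟨y, hy, rfl⟩

section Support

variable {X : Type*} [TopologicalSpace X] [MeasurableSpace X] [BorelSpace X]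
  [SecondCountableTopology X]

theorem suppMeasure_preimage (μ : Measure X) {V : Set X} :
    suppMeasure μ (Subtype.val ⁻¹' V) = μ V := by
  rw [suppMeasure, (MeasurableEmbedding.subtype_coe
    Measure.isClosed_support.measurableSet).comap_apply, Subtype.image_preimage_coe, Set.inter_comm]
  exact measure_inter_conull Measure.support_mem_ae

theorem isProbabilityMeasure_suppMeasure (μ : Measure X) [IsProbabilityMeasure μ] :
    IsProbabilityMeasure (suppMeasure μ) :=
  ⟨by rw [← Set.preimage_univ, suppMeasure_preimage, measure_univ]⟩

theorem IsGoodMeasure.measure_singleton_eq_zero [T2Space X] {μ : Measure X}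
    (h : IsGoodMeasure (suppMeasure μ)) (x : X) : μ {x} = 0 := by
  by_cases hx : x ∈ μ.support
  · have : ({⟨x, hx⟩} : Set μ.support) = Subtype.val ⁻¹' {x} := by
      ext y; simp [Subtype.ext_iff]
    rw [← suppMeasure_preimage μ, ← this]
    exact h.noAtoms _
  · exact measure_mono_null (Set.singleton_subset_iff.2 hx) Measure.support_mem_ae

theorem IsGoodMeasure.isGoodClopen_of_suppMeasure [CompactSpace X] [T2Space X]
    [TotallyDisconnectedSpace X] {μ : Measure X} (h : IsGoodMeasure (suppMeasure μ))
    {V : Set X} (hV : IsClopen V) : IsGoodClopen μ V := by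
  intro U hU hlt
  rw [← suppMeasure_preimage μ, ← suppMeasure_preimage μ (V := V)] at hlt
  obtain ⟨W, hW, hWV, hWm⟩ := h.good _ (hV.preimage continuous_subtype_val) _
    (hU.preimage continuous_subtype_val) hlt
  obtain ⟨W', hW', rfl⟩ := exists_isClopen_preimage_support μ hW
  refine ⟨W' ∩ V, hW'.inter hV, Set.inter_subset_right, ?_⟩
  rw [← suppMeasure_preimage μ (V := U), ← hWm, ← suppMeasure_preimage μ (V := W' ∩ V),
    Set.preimage_inter, Set.inter_eq_left.2 hWV]

end Support

section GoodSums

variable {X : Type*} [TopologicalSpace X] [MeasurableSpace X] [BorelSpace X]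

/-- The clopen values of a measure all of whose clopen sets are good are closed under sums not
exceeding the total mass. -/
theorem exists_isClopen_measureReal_add {μ : Measure X} [IsProbabilityMeasure μ]
    (hμ : ∀ V : Set X, IsClopen V → IsGoodClopen μ V) {U V : Set X} (hU : IsClopen U)
    (hV : IsClopen V) (h : μ.real U + μ.real V ≤ 1) :
    ∃ W : Set X, IsClopen W ∧ μ.real W = μ.real U + μ.real V := by
  have hc : μ.real Uᶜ = 1 - μ.real U := probReal_compl_eq_one_sub hU.2.measurableSet
  rcases (show μ.real V ≤ μ.real Uᶜ by linarith).lt_or_eq with hlt | heq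
  · obtain ⟨W, hW, hWU, hWm⟩ := hμ _ hU.compl V hV
      ((ENNReal.toReal_lt_toReal (measure_ne_top _ _) (measure_ne_top _ _)).1 hlt)
    refine ⟨U ∪ W, hU.union hW, ?_⟩
    rw [measureReal_union (Set.disjoint_left.2 fun x hx hx' => hWU hx' hx) hW.2.measurableSet,
      measureReal_def μ W, hWm, measureReal_def μ V]
  · exact ⟨Set.univ, isClopen_univ, by rw [probReal_univ]; linarith⟩

theorem exists_isClopen_measureReal_sum {μ : Measure X} [IsProbabilityMeasure μ]
    (hμ : ∀ V : Set X, IsClopen V → IsGoodClopen μ V) {ι : Type*} (s : Finset ι) (V : ι → Set X)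
    (hV : ∀ i, IsClopen (V i)) (h : ∑ i ∈ s, μ.real (V i) ≤ 1) :
    ∃ W : Set X, IsClopen W ∧ μ.real W = ∑ i ∈ s, μ.real (V i) := by
  classical
  induction s using Finset.induction_on with
  | empty => exact ⟨∅, isClopen_empty, by simp⟩
  | insert i s hi ih =>
    rw [Finset.sum_insert hi] at h ⊢
    obtain ⟨W, hW, hWm⟩ := ih (by have := measureReal_nonneg (μ := μ) (s := V i); linarith)
    rw [← hWm] at h ⊢
    exact exists_isClopen_measureReal_add hμ (hV i) hW h

end GoodSums

/-! ### The block that carries an ergodic measure -/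

namespace StationaryBratteli

variable {B : StationaryBratteli}

theorem pow_inc_vertex_pos (x : B.Path) (n j : ℕ) :
    0 < (B.inc ^ j) (vertex x (n + j)) (vertex x n) := by
  induction j with
  | zero => simp
  | succ j ih =>
    rw [pow_succ', matrix_mul_pos_iff]
    exact ⟨_, inc_vertex_pos x (n + j), ih⟩

theorem HasCount.exists_mem {n : ℕ} {V : Set B.Path} {c : Fin B.size → ℕ} (h : HasCount n V c)
    {v : Fin B.size} (hv : c v ≠ 0) : ∃ y ∈ V, vertex y n = v := by
  obtain ⟨F, -, rfl, hc⟩ := h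
  obtain ⟨y, hy⟩ := Finset.card_pos.1 (Nat.pos_of_ne_zero (hc v ▸ hv))
  rw [Finset.mem_filter] at hy
  exact ⟨y, Set.mem_iUnion₂.2 ⟨y, hy.1, mem_cylinder_self y n⟩, hy.2⟩

theorem exists_cylinder_measure_lt {μ : Measure B.Path} [IsFiniteMeasure μ]
    (hμ : ∀ x, μ {x} = 0) {ε : ℝ} (hε : 0 < ε) :
    ∃ N, ∀ n, N ≤ n → ∀ x : B.Path, μ.real (cylinder x n) < ε := by
  refine eventually_forall_cylinder (P := fun s => μ.real s < ε)
    (fun s t hst ht => (measureReal_mono hst).trans_lt ht) fun x => ?_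
  have h := tendsto_measure_iInter_atTop (μ := μ) (s := fun n => cylinder x n)
    (fun n => (isClopen_cylinder x n).2.measurableSet.nullMeasurableSet)
    (fun n m h => cylinder_anti x h) ⟨0, measure_ne_top _ _⟩
  rw [iInter_cylinder, hμ] at h
  obtain ⟨n, hn⟩ := (h.eventually (gt_mem_nhds (ENNReal.ofReal_pos.2 hε))).exists
  exact ⟨n, (ENNReal.lt_ofReal_iff_toReal_lt (measure_ne_top _ _)).1 hn⟩

/-- Ergodicity: some vertex is visited infinitely often, at multiples of `k`, by almost every
path. -/
theorem IsErgodic.exists_recurrent_vertex {μ : Measure B.Path} [IsProbabilityMeasure μ]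
    (herg : IsErgodic μ) {k : ℕ} (hk : 0 < k) :
    ∃ e : Fin B.size, ∀ᵐ x ∂μ, ∀ N, ∃ n, N ≤ n ∧ vertex x (k * n) = e := by
  let A : Fin B.size → Set B.Path := fun e => {x | ∀ N, ∃ n, N ≤ n ∧ vertex x (k * n) = e}
  have hcl : ∀ m e, IsClopen {x : B.Path | vertex x m = e} := fun m e =>
    (isClopen_discrete {e}).preimage (continuous_vertex m)
  have hA : ∀ e, MeasurableSet (A e) := by
    intro e
    have : A e = ⋂ N, ⋃ n, ⋃ _ : N ≤ n, {x : B.Path | vertex x (k * n) = e} := by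
      ext x; simp [A]
    rw [this]
    exact MeasurableSet.iInter fun N => MeasurableSet.iUnion fun n => MeasurableSet.iUnion fun _ =>
      (hcl _ _).2.measurableSet
  have hsat : ∀ e, IsSaturated (A e) := by
    intro e x y hxy hx N
    obtain ⟨L, hL⟩ := hxy.exists_vertex_eq
    obtain ⟨n, hn, hv⟩ := hx (max N L)
    refine ⟨n, (le_max_left _ _).trans hn, ?_⟩
    rw [← hL (k * n) (((le_max_right _ _).trans hn).trans (Nat.le_mul_of_pos_left n hk)), hv]
  have huniv : ⋃ e, A e = Set.univ := by
    refine Set.eq_univ_of_forall fun x => ?_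
    obtain ⟨e, he⟩ := Finite.exists_infinite_fiber fun n => vertex x (k * n)
    rw [Set.infinite_coe_iff] at he
    refine Set.mem_iUnion.2 ⟨e, fun N => ?_⟩
    obtain ⟨n, hn, hN⟩ := he.exists_gt N
    exact ⟨n, hN.le, hn⟩
  by_contra! hcon
  have h0 : ∀ e, μ (A e) = 0 := fun e =>
    (herg _ (hA e) (hsat e)).resolve_right fun h1 => hcon e <| by
      have h2 : ∀ᵐ x ∂μ, x ∈ A e := (prob_compl_eq_zero_iff (hA e)).2 h1
      exact h2.mono fun x hx ⟨N, hN⟩ => by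
        obtain ⟨n, hn, hv⟩ := hx N
        exact hN n hn hv
  have : μ (⋃ e, A e) = 0 := measure_iUnion_null h0
  rw [huniv, measure_univ] at this
  exact one_ne_zero this

/-- Along the multiples of a suitable `k`, the vertices of positive mass are exactly those that
lead to a recurrent vertex `e`, and the vertices in the class of `e` form a positive block `E`
that no mass leaves. The clopen values of a good measure are generated by the masses in this
block: cylinders of small mass can be moved into a cylinder over `e`. -/
theorem exists_positive_block {μ : Measure B.Path} [IsProbabilityMeasure μ]
    (hinv : IsInvariant μ) (herg : IsErgodic μ) (hatom : ∀ x, μ {x} = 0)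
    (hgood : ∀ V : Set B.Path, IsClopen V → IsGoodClopen μ V) :
    ∃ (k : ℕ) (E : Finset (Fin B.size)) (M : Matrix E E ℕ)
      (h : IsHarmonic M fun n v => mass μ (k * n) v), 0 < k ∧ E.Nonempty ∧
      (∀ v w, 1 ≤ M v w) ∧ (∀ n (v : E), 0 < mass μ (k * n) v) ∧
      ∀ U : Set B.Path, IsClopen U → μ.real U ∈ h.valueGroup := by
  obtain ⟨k, hk, hpat⟩ := exists_pow_pattern_idempotent B.inc
  obtain ⟨e, he⟩ := herg.exists_recurrent_vertex hk
  have hmass := isHarmonic_of_cylinder (fun n x => hinv.measureReal_cylinder x n)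
  have hstep : ∀ n, k * (n + 1) = k * n + k := fun n => by ring
  -- `R w v` means that `k` edges lead from `w` to `v`; by the choice of `k` it also holds when a
  -- positive multiple of `k` edges does, and hence it is transitive
  let R : Fin B.size → Fin B.size → Prop := fun w v => 0 < (B.inc ^ k) v w
  have hpath : ∀ (x : B.Path) n m, n < m → R (vertex x (k * n)) (vertex x (k * m)) := by
    intro x n m hnm
    obtain ⟨j, rfl⟩ := Nat.exists_eq_add_of_le hnm.le
    have := pow_inc_vertex_pos x (k * n) (k * j)
    rw [← mul_add] at this
    exact (hpat j (by omega) _ _).1 this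
  have htrans : ∀ u v w, R u v → R v w → R u w := by
    intro u v w huv hvw
    refine (hpat 2 two_pos _ _).1 ?_
    rw [mul_two, pow_add, matrix_mul_pos_iff]
    exact ⟨v, hvw, huv⟩
  have hR : ∀ n w, 0 < mass μ (k * n) w → R w e := by
    intro n w hw
    obtain ⟨x, rfl⟩ := exists_vertex_eq (k * n) w
    rw [← hinv.measureReal_cylinder] at hw
    have hne : μ (cylinder x (k * n)) ≠ 0 := fun h0 => by
      simp [measureReal_def, h0] at hw
    obtain ⟨z, hz, hze⟩ : ∃ z ∈ cylinder x (k * n),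
        ∀ N, ∃ n, N ≤ n ∧ vertex z (k * n) = e := by
      by_contra! hcon
      exact hne (measure_mono_null (fun z hz => by
        simpa using hcon z hz) (ae_iff.1 he))
    obtain ⟨m, hm, hv⟩ := hze (n + 1)
    rw [← hv, ← vertex_eq_of_mem_cylinder hz le_rfl]
    exact hpath z n m hm
  -- mass flows backwards along the relation
  have hback : ∀ n w v, R w v → 0 < mass μ (k * (n + 1)) v → 0 < mass μ (k * n) w := by
    intro n w v hwv hv
    rw [hmass.pow (k * n) k w, ← hstep]
    exact Finset.sum_pos' (fun u _ => mul_nonneg (Nat.cast_nonneg _) (mass_nonneg ..))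
      ⟨v, Finset.mem_univ v, mul_pos (Nat.cast_pos.2 hwv) hv⟩
  have hee : R e e := by
    have : ∃ x : B.Path, ∀ N, ∃ n, N ≤ n ∧ vertex x (k * n) = e := he.exists
    obtain ⟨x, hx⟩ := this
    obtain ⟨n, -, hn⟩ := hx 0
    obtain ⟨m, hm, hm'⟩ := hx (n + 1)
    have := hpath x n m hm
    rwa [hn, hm'] at this
  have hepos : ∀ n, 0 < mass μ (k * n) e := by
    intro n
    by_contra hn
    have hnot : ∀ m, n ≤ m → mass μ (k * m) e = 0 := by
      intro m hm
      by_contra hm0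
      have hm1 : 0 < mass μ (k * m) e := (mass_nonneg ..).lt_of_ne (Ne.symm hm0)
      induction m, hm using Nat.le_induction with
      | base => exact hn hm1
      | succ m hm ih => exact ih (hback m e e hee hm1).ne' (hback m e e hee hm1)
    have hnull : ∀ m, n ≤ m → μ {x | vertex x (k * m) = e} = 0 := by
      intro m hm
      refine measure_null_of_locally_null _ fun x hx => ⟨cylinder x (k * m),
        mem_nhdsWithin_of_mem_nhds ((isClopen_cylinder x _).2.mem_nhds (mem_cylinder_self x _)), ?_⟩
      have h0 := hinv.measureReal_cylinder x (k * m)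
      rw [show vertex x (k * m) = e from hx, hnot m hm] at h0
      exact (measureReal_eq_zero_iff (measure_ne_top _ _)).1 h0
    have h1 : ∀ᵐ x ∂μ, ∀ m, n ≤ m → vertex x (k * m) ≠ e :=
      ae_all_iff.2 fun m => by
        by_cases hm : n ≤ m
        · have : ∀ᵐ x ∂μ, vertex x (k * m) ≠ e := by
            rw [ae_iff]; simpa using hnull m hm
          exact this.mono fun x hx _ => hx
        · exact .of_forall fun x h => (hm h).elim
    obtain ⟨x, hx, hx'⟩ := (h1.and he).exists
    obtain ⟨m, hm, hv⟩ := hx' n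
    exact hx m hm hv
  have hpos : ∀ n w, R w e → 0 < mass μ (k * n) w := fun n w hw =>
    hback n w e hw (hepos _)
  classical
  let E : Finset (Fin B.size) := Finset.univ.filter fun v => R e v ∧ R v e
  have hE : ∀ v, v ∈ E ↔ R e v ∧ R v e := fun v => by simp [E]
  have hout : ∀ n v, R e v → v ∉ E → mass μ (k * n) v = 0 := by
    intro n v hev hv
    by_contra h0
    exact hv <| (hE v).2 ⟨hev, hR n v ((mass_nonneg ..).lt_of_ne (Ne.symm h0))⟩
  have hsumE : ∀ f : Fin B.size → ℝ, (∀ v ∉ E, f v = 0) → ∑ v, f v = ∑ v : E, f v := by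
    intro f hf
    rw [Finset.sum_coe_sort E f]
    exact (Finset.sum_subset (Finset.subset_univ E) fun v _ hv => hf v hv).symm
  have hharm : IsHarmonic (Matrix.of fun v w : E => (B.inc ^ k) v w)
      fun n (v : E) => mass μ (k * n) v := by
    intro n w
    simp only [Matrix.of_apply]
    rw [hmass.pow (k * n) k w, hstep]
    refine hsumE (fun v => ((B.inc ^ k) v w : ℝ) * mass μ (k * n + k) v) fun v hv => ?_
    rcases Nat.eq_zero_or_pos ((B.inc ^ k) v w) with h0 | h0
    · simp [h0]
    · rw [← hstep, hout _ v (htrans _ _ _ ((hE w).1 w.2).1 h0) hv, mul_zero]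
  refine ⟨k, E, _, hharm, hk, ⟨e, (hE e).2 ⟨hee, hee⟩⟩,
    fun v w => htrans _ _ _ ((hE w).1 w.2).2 ((hE v).1 v.2).1,
    fun n v => hpos n v ((hE v).1 v.2).2, fun U hU => ?_⟩
  -- clopen subsets of a cylinder over `e`
  obtain ⟨x₀, hx₀⟩ := exists_vertex_eq (k * 0) e
  have hsub : ∀ W : Set B.Path, IsClopen W → W ⊆ cylinder x₀ (k * 0) →
      μ.real W ∈ hharm.valueGroup := by
    intro W hW hWx
    obtain ⟨N, hN⟩ := exists_hasCount hW
    obtain ⟨c, hc⟩ := hN (k * (N + 1)) (by nlinarith)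
    rw [hc.measureReal_eq fun x => hinv.measureReal_cylinder x _]
    refine ⟨N + 1, fun v => c v, ?_⟩
    simp only [Int.cast_natCast]
    refine hsumE (fun v => (c v : ℝ) * mass μ (k * (N + 1)) v) fun v hv => ?_
    by_cases hcv : c v = 0
    · simp [hcv]
    · obtain ⟨y, hy, hyv⟩ := hc.exists_mem hcv
      have := hpath y 0 (N + 1) (Nat.succ_pos N)
      rw [hyv, vertex_eq_of_mem_cylinder (hWx hy) le_rfl, hx₀] at this
      rw [hout _ v this hv, mul_zero]
  obtain ⟨N, hN⟩ := exists_cylinder_measure_lt hatom (hepos 0)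
  obtain ⟨N', hN'⟩ := exists_hasCount hU
  obtain ⟨c, hc⟩ := hN' (max N N') (le_max_right _ _)
  rw [hc.measureReal_eq fun x => hinv.measureReal_cylinder x _]
  refine sum_mem fun v _ => ?_
  rw [← nsmul_eq_mul]
  refine nsmul_mem ?_ _
  obtain ⟨y, rfl⟩ := exists_vertex_eq (max N N') v
  rw [← hinv.measureReal_cylinder]
  have hlt := hN _ (le_max_left N N') y
  rw [← hx₀, ← hinv.measureReal_cylinder] at hlt
  obtain ⟨W, hW, hWx, hWm⟩ := hgood _ (isClopen_cylinder x₀ (k * 0)) _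
    (isClopen_cylinder y (max N N'))
    ((ENNReal.toReal_lt_toReal (measure_ne_top _ _) (measure_ne_top _ _)).1 hlt)
  rw [measureReal_def, ← hWm]
  exact hsub W hW hWx

/-- The clopen values of a good ergodic invariant measure are the elements of `[0, 1]` in the
value group of a harmonic sequence for a matrix with large entries. -/
theorem exists_block_of_good {μ : Measure B.Path} [IsProbabilityMeasure μ]
    (hinv : IsInvariant μ) (herg : IsErgodic μ) (hatom : ∀ x, μ {x} = 0)
    (hgood : ∀ V : Set B.Path, IsClopen V → IsGoodClopen μ V) :
    ∃ (m : ℕ) (M : Matrix (Fin m) (Fin m) ℕ) (q : ℕ → Fin m → ℝ) (h : IsHarmonic M q),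
      0 < m ∧ (∀ v w, 4 ≤ M v w) ∧ (∀ n v, 0 < q n v) ∧
      ∀ g : ℝ, (∃ V : Set B.Path, IsClopen V ∧ μ.real V = g) ↔
        0 ≤ g ∧ g ≤ 1 ∧ g ∈ h.valueGroup := by
  classical
  obtain ⟨k, E, M, h, hk, ⟨e, he⟩, hM, hpos, hval⟩ :=
    exists_positive_block hinv herg hatom hgood
  have : Nonempty E := ⟨⟨e, he⟩⟩
  obtain ⟨j, hj, hj4⟩ := h.exists_pow_ge hpos hM (fun v => by
    refine Metric.tendsto_atTop.2 fun ε hε => ?_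
    obtain ⟨N, hN⟩ := exists_cylinder_measure_lt hatom hε
    refine ⟨N, fun n hn => ?_⟩
    obtain ⟨y, hy⟩ := exists_vertex_eq (k * n) v.1
    rw [Real.dist_0_eq_abs, abs_of_nonneg (mass_nonneg ..), ← hy, ← hinv.measureReal_cylinder]
    exact hN _ (hn.trans (Nat.le_mul_of_pos_left n hk)) y) 4
  let σ := (Fintype.equivFin E).symm
  have h' : IsHarmonic (Matrix.of fun v w => (M ^ j) (σ v) (σ w))
      (fun n v => mass μ (k * (j * n)) (σ v)) := fun n w => by
    rw [h.telescope j n (σ w)]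
    exact (Equiv.sum_comp σ fun v => ((M ^ j) v (σ w) : ℝ) * mass μ (k * (j * (n + 1))) v).symm
  have hG : h'.valueGroup = h.valueGroup := by
    rw [← h.valueGroup_telescope hj]
    ext g
    constructor
    · rintro ⟨n, a, rfl⟩
      refine ⟨n, fun v => a (σ.symm v), ?_⟩
      rw [← Equiv.sum_comp σ]
      simp
    · rintro ⟨n, a, rfl⟩
      refine ⟨n, fun v => a (σ v), ?_⟩
      rw [← Equiv.sum_comp σ]
  refine ⟨Fintype.card E, _, _, h', Fintype.card_pos, fun v w => hj4 _ _, fun n v => hpos _ _,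
    fun g => ⟨?_, ?_⟩⟩
  · rintro ⟨V, hV, rfl⟩
    exact ⟨measureReal_nonneg, measureReal_le_one, hG ▸ hval V hV⟩
  · rintro ⟨hg0, hg1, hg⟩
    rcases hg0.eq_or_lt with rfl | hg0
    · exact ⟨∅, isClopen_empty, by simp⟩
    obtain ⟨n, a, -, rfl⟩ := h.exists_nat_rep hpos hM (hG ▸ hg) hg0
    -- list the cylinders with multiplicity
    choose y hy using fun v : E => exists_vertex_eq (k * n) v.1
    have hsum : ∑ v : E, (a v : ℝ) * mass μ (k * n) v =
        ∑ i ∈ Finset.univ.sigma fun v : E => Finset.range (a v),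
          μ.real (cylinder (y i.1) (k * n)) := by
      rw [Finset.sum_sigma]
      refine Finset.sum_congr rfl fun v _ => ?_
      simp [hinv.measureReal_cylinder, hy]
    rw [hsum] at hg1 ⊢
    exact exists_isClopen_measureReal_sum hgood _ _ (fun i => isClopen_cylinder _ _) hg1

end StationaryBratteli

/-! ### Multiple edges, and invariants of orbit equivalence -/

namespace StationaryBratteli

variable {B C : StationaryBratteli}

/-- If all edges are multiple, one edge of a path can be exchanged for a parallel one. -/
theorem exists_twin (hB : ∀ v w, 0 < B.inc v w → 2 ≤ B.inc v w) (x : B.Path) (n : ℕ) :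
    ∃ y ∈ cylinder x n, y.1.2 n ≠ x.1.2 n ∧ ∀ k, n < k → y.1.2 k = x.1.2 k := by
  obtain ⟨e, hes, her, hne⟩ : ∃ e : B.Edge, src e = src (x.1.2 n) ∧ rng e = rng (x.1.2 n) ∧
      e ≠ x.1.2 n := by
    obtain ⟨⟨a, b⟩, i⟩ := x.1.2 n
    have h2 : 2 ≤ B.inc b a := hB _ _ (Fin.pos i)
    have : Nontrivial (Fin (B.inc b a)) := Fin.nontrivial_iff_two_le.2 h2
    obtain ⟨i', hi'⟩ := exists_ne i
    exact ⟨⟨(a, b), i'⟩, rfl, rfl, fun h => hi' (by simpa using h)⟩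
  have hf : ∀ k, rng ((fun k => Nat.casesOn k e fun k => x.1.2 (n + 1 + k) : ℕ → B.Edge) k) =
      src ((fun k => Nat.casesOn k e fun k => x.1.2 (n + 1 + k) : ℕ → B.Edge) (k + 1)) := by
    rintro (_ | k)
    · exact her.trans (x.2.2 n)
    · exact x.2.2 _
  refine ⟨splice x n _ hes hf, splice_mem_cylinder .., ?_, fun k hk => ?_⟩
  · have := splice_apply x n _ hes hf 0
    rw [add_zero] at this
    rw [this]
    exact hne
  · obtain ⟨j, rfl⟩ := Nat.exists_eq_add_of_lt hk
    have := splice_apply x n _ hes hf (j + 1)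
    rw [add_assoc, this]
    simp only [add_comm, add_left_comm]

theorem isAperiodic_of_two_le (hB : ∀ v w, 0 < B.inc v w → 2 ≤ B.inc v w) : B.IsAperiodic := by
  intro x
  choose y hy hyn hyk using exists_twin hB x
  have hinj : Function.Injective y := by
    have : ∀ n m, n < m → y n ≠ y m := fun n m hnm h => hyn n (by rw [h]; exact (hy m).2 n hnm)
    intro n m h
    rcases lt_trichotomy n m with h' | h' | h'
    · exact (this n m h' h).elim
    · exact h'
    · exact (this m n h' h.symm).elim
  exact Set.infinite_of_injective_forall_mem hinj fun n =>
    ⟨n + 1, fun k hk => (hyk n k hk).symm⟩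

theorem isCantor_of_two_le (hB : ∀ v w, 0 < B.inc v w → 2 ≤ B.inc v w) : B.IsCantor := by
  refine ⟨fun x _ => accPt_iff_nhds.2 fun U hU => ?_⟩
  obtain ⟨n, hn⟩ := exists_cylinder_subset hU
  obtain ⟨y, hy, hyn, -⟩ := exists_twin hB x n
  exact ⟨y, ⟨hn hy, Set.mem_univ y⟩, fun h => hyn (by rw [h])⟩

theorem isSimple_of_inc_pos (hB : ∀ v w, 0 < B.inc v w) : B.IsSimple := by
  refine fun x y => mem_closure_iff_cylinder.2 fun n => ?_
  obtain ⟨z, hz, hxz⟩ := exists_mem_cylinder_tailEquiv y x n (hB _ _)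
  exact ⟨z, hz, hxz⟩

theorem mem_minimalComponents {A : Set B.Path} : A ∈ B.minimalComponents ↔
    Minimal (fun C : Set B.Path => IsClosed C ∧ C.Nonempty ∧ IsSaturated C) A := Iff.rfl

theorem IsSimple.minimalComponents_eq (h : B.IsSimple) : B.minimalComponents = {Set.univ} := by
  have key : ∀ D : Set B.Path, IsClosed D → D.Nonempty → IsSaturated D → D = Set.univ := by
    rintro D hD ⟨x, hx⟩ hsat
    exact Set.eq_univ_of_univ_subset
      ((h x).closure_eq ▸ hD.closure_subset_iff.2 fun y hy => hsat x y hy hx)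
  ext A
  constructor
  · intro hA
    rw [mem_minimalComponents] at hA
    exact key A hA.prop.1 hA.prop.2.1 hA.prop.2.2
  · rintro rfl
    exact ⟨⟨isClosed_univ, Set.univ_nonempty, fun _ _ _ _ => Set.mem_univ _⟩,
      fun D hD _ => (key D hD.1 hD.2.1 hD.2.2).ge⟩

theorem OrbitEquivalent.symm (h : OrbitEquivalent B C) : OrbitEquivalent C B := by
  obtain ⟨f, hf⟩ := h
  exact ⟨f.symm, fun x y => by rw [hf]; simp⟩

theorem OrbitEquivalent.isSimple (h : OrbitEquivalent B C) (hB : B.IsSimple) : C.IsSimple := by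
  obtain ⟨f, hf⟩ := h
  intro x
  have := (hB (f.symm x)).preimage f.symm.isOpenMap
  convert this using 1
  ext y
  simp [hf]

theorem OrbitEquivalent.encard_minimalComponents_le (h : OrbitEquivalent B C) :
    B.minimalComponents.encard ≤ C.minimalComponents.encard := by
  obtain ⟨f, hf⟩ := h
  refine Set.encard_le_encard_of_injOn (f := fun A => f '' A) (fun A hA => ?_)
    fun A _ A' _ h => f.injective.image_injective h
  rw [mem_minimalComponents] at hA
  refine ⟨⟨f.isClosedMap _ hA.prop.1, hA.prop.2.1.image f, ?_⟩, fun D hD hDA => ?_⟩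
  · rintro _ y hxy ⟨x, hx, rfl⟩
    exact ⟨f.symm y, hA.prop.2.2 x _ ((hf _ _).2 (by simpa using hxy)) hx, by simp⟩
  · have hsub : A ⊆ f ⁻¹' D := by
      refine hA.le_of_le ⟨hD.1.preimage f.continuous, ?_, fun x y hxy hx => ?_⟩ fun x hx => ?_
      · obtain ⟨y, hy⟩ := hD.2.1
        exact ⟨f.symm y, by simpa using hy⟩
      · exact hD.2.2 _ _ ((hf x y).1 hxy) hx
      · obtain ⟨x', hx', he⟩ := hDA hx
        exact f.injective he ▸ hx'
    exact Set.image_subset_iff.2 hsub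

end StationaryBratteli

/-! ### A positive block with additional sources -/

/-- The incidence matrix of a positive block `M` to which `i` sources are added. Every source has
two loops, receives no other edge, and emits as many edges to the vertex `e` of the block as make
a source as heavy as the whole block together (the row sum of `M` at `e`, less the two loops). -/
def sourceBlock {m : ℕ} (i : ℕ) (M : Matrix (Fin m) (Fin m) ℕ) :
    Fin i ⊕ Fin m → Fin i ⊕ Fin m → ℕ
  | .inl j, .inl j' => if j = j' then 2 else 0
  | .inl _, .inr _ => 0
  | .inr e, .inl _ => ∑ w, M e w - 2
  | .inr e, .inr e' => M e e'

namespace StationaryBratteli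

variable {D : StationaryBratteli} {i m : ℕ} {M : Matrix (Fin m) (Fin m) ℕ}

section Vertices

variable {φ : Fin i ⊕ Fin m ≃ Fin D.size}

theorem two_le_sum_sub (hM : ∀ v w, 4 ≤ M v w) (e : Fin m) : 2 ≤ ∑ w, M e w - 2 := by
  have := Finset.single_le_sum (f := fun w => M e w) (fun _ _ => Nat.zero_le _) (Finset.mem_univ e)
  have := hM e e
  omega

theorem two_le_inc_of_pos (hφ : ∀ v w, D.inc (φ v) (φ w) = sourceBlock i M v w)
    (hM : ∀ v w, 4 ≤ M v w) (v w : Fin D.size) (h : 0 < D.inc v w) : 2 ≤ D.inc v w := by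
  obtain ⟨v, rfl⟩ := φ.surjective v
  obtain ⟨w, rfl⟩ := φ.surjective w
  rw [hφ] at h ⊢
  rcases v with j | e <;> rcases w with j' | e'
  · simp only [sourceBlock] at h ⊢
    split_ifs at h ⊢ <;> omega
  · simp [sourceBlock] at h
  · exact two_le_sum_sub hM e
  · exact le_trans (by norm_num) (hM e e')

theorem vertex_eq_source_of_le (hφ : ∀ v w, D.inc (φ v) (φ w) = sourceBlock i M v w)
    {x : D.Path} {n : ℕ} {j : Fin i} (h : vertex x n = φ (.inl j)) {k : ℕ} (hk : k ≤ n) :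
    vertex x k = φ (.inl j) := by
  induction n with
  | zero => rwa [Nat.le_zero.1 hk]
  | succ n ih =>
    rcases Nat.of_le_succ hk with hk | rfl
    · refine ih ?_ hk
      have hpos := inc_vertex_pos x n
      obtain ⟨w, hw⟩ := φ.surjective (vertex x n)
      rw [h, ← hw, hφ] at hpos
      rw [← hw]
      rcases w with j' | e
      · by_cases hj : j = j'
        · rw [hj]
        · simp [sourceBlock, hj] at hpos
      · simp [sourceBlock] at hpos
    · exact h

/-- The paths that stay at a source. -/
def sourceComponent (φ : Fin i ⊕ Fin m ≃ Fin D.size) (j : Fin i) : Set D.Path :=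
  {x | ∀ n, vertex x n = φ (.inl j)}

theorem isClosed_sourceComponent (j : Fin i) : IsClosed (sourceComponent φ j) := by
  have : sourceComponent φ j = ⋂ n, {x | vertex x n = φ (.inl j)} := by
    ext x; simp [sourceComponent]
  rw [this]
  exact isClosed_iInter fun n => isClosed_eq (continuous_vertex n) continuous_const

theorem sourceComponent_nonempty (hφ : ∀ v w, D.inc (φ v) (φ w) = sourceBlock i M v w)
    (j : Fin i) : (sourceComponent φ j).Nonempty := by
  obtain ⟨x, hx⟩ := exists_vertex_eq 0 (φ (.inl j))
  obtain ⟨e, he, he'⟩ := exists_edge_of_pos (B := D) (v := φ (.inl j)) (w := φ (.inl j))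
    (by rw [hφ]; simp [sourceBlock])
  refine ⟨splice x 0 (fun _ => e) (he.trans hx.symm) fun _ => he'.trans he.symm, fun n => ?_⟩
  have := splice_apply x 0 (fun _ => e) (he.trans hx.symm) (fun _ => he'.trans he.symm) n
  rw [zero_add] at this
  exact (congrArg src this).trans he

theorem isSaturated_sourceComponent (hφ : ∀ v w, D.inc (φ v) (φ w) = sourceBlock i M v w)
    (j : Fin i) : IsSaturated (sourceComponent φ j) := by
  intro x y hxy hx n
  obtain ⟨N, hN⟩ := hxy.exists_vertex_eq
  exact vertex_eq_source_of_le hφ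
    ((hN (max n N) (le_max_right _ _)).symm.trans (hx _)) (le_max_left n N)

/-- A path that leaves its source can be approached from every source, so closed saturated sets
contain a source component. -/
theorem exists_sourceComponent_subset (hφ : ∀ v w, D.inc (φ v) (φ w) = sourceBlock i M v w)
    (hM : ∀ v w, 4 ≤ M v w) (hi : 1 ≤ i) {A : Set D.Path} (hA : IsClosed A) (hne : A.Nonempty)
    (hsat : IsSaturated A) : ∃ j, sourceComponent φ j ⊆ A := by
  obtain ⟨y, hy⟩ := hne
  by_cases hcase : ∃ N e, vertex y N = φ (.inr e)
  · obtain ⟨N, e, hN⟩ := hcase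
    have hlate : ∀ n, N ≤ n → ∃ e', vertex y n = φ (.inr e') := by
      intro n hn
      obtain ⟨w, hw⟩ := φ.surjective (vertex y n)
      rcases w with j | e'
      · have := vertex_eq_source_of_le hφ hw.symm hn
        rw [hN] at this
        exact absurd (φ.injective this) (by simp)
      · exact ⟨e', hw.symm⟩
    refine ⟨⟨0, hi⟩, fun z hz => hA.closure_subset (mem_closure_iff_cylinder.2 fun n => ?_)⟩
    obtain ⟨e', he'⟩ := hlate (max n N + 1) ((le_max_right _ _).trans (Nat.le_succ _))
    obtain ⟨u, hu, hyu⟩ := exists_mem_cylinder_tailEquiv z y (max n N) (by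
      rw [he', hz, hφ]
      have := two_le_sum_sub hM e'
      exact lt_of_lt_of_le two_pos this)
    exact ⟨u, cylinder_anti z (le_max_left n N) hu, hsat y u hyu hy⟩
  · have hall : ∀ n, ∃ j, vertex y n = φ (.inl j) := by
      intro n
      obtain ⟨w, hw⟩ := φ.surjective (vertex y n)
      rcases w with j | e
      · exact ⟨j, hw.symm⟩
      · exact (hcase ⟨n, e, hw.symm⟩).elim
    obtain ⟨j, hj⟩ := hall 0
    have hyj : ∀ n, vertex y n = φ (.inl j) := by
      intro n
      obtain ⟨j', hj'⟩ := hall n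
      have := vertex_eq_source_of_le hφ hj' (Nat.zero_le n)
      rw [hj', ← this, hj]
    refine ⟨j, fun z hz => hA.closure_subset (mem_closure_iff_cylinder.2 fun n => ?_)⟩
    obtain ⟨u, hu, hyu⟩ := exists_mem_cylinder_tailEquiv_of_vertex_eq z y n
      ((hyj n).trans (hz n).symm)
    exact ⟨u, hu, hsat y u hyu hy⟩

theorem minimalComponents_eq_range (hφ : ∀ v w, D.inc (φ v) (φ w) = sourceBlock i M v w)
    (hM : ∀ v w, 4 ≤ M v w) (hi : 1 ≤ i) :
    D.minimalComponents = Set.range (sourceComponent φ) := by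
  have hK : ∀ j, IsClosed (sourceComponent φ j) ∧ (sourceComponent φ j).Nonempty ∧
      IsSaturated (sourceComponent φ j) := fun j =>
    ⟨isClosed_sourceComponent j, sourceComponent_nonempty hφ j, isSaturated_sourceComponent hφ j⟩
  ext A
  constructor
  · intro hA
    rw [mem_minimalComponents] at hA
    obtain ⟨j, hj⟩ := exists_sourceComponent_subset hφ hM hi hA.prop.1 hA.prop.2.1 hA.prop.2.2
    exact ⟨j, hj.antisymm (hA.le_of_le (hK j) hj)⟩
  · rintro ⟨j, rfl⟩
    refine ⟨hK j, fun A hA hAj => ?_⟩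
    obtain ⟨j', hj'⟩ := exists_sourceComponent_subset hφ hM hi hA.1 hA.2.1 hA.2.2
    obtain ⟨x, hx⟩ := sourceComponent_nonempty hφ j'
    have hjj : j' = j := by
      have := (hx 0).symm.trans (hAj (hj' hx) 0)
      simpa using φ.injective this
    exact hjj ▸ hj'

theorem encard_minimalComponents (hφ : ∀ v w, D.inc (φ v) (φ w) = sourceBlock i M v w)
    (hM : ∀ v w, 4 ≤ M v w) (hi : 1 ≤ i) : D.minimalComponents.encard = i := by
  have hinj : Function.Injective (sourceComponent φ) := by
    intro j j' h
    obtain ⟨x, hx⟩ := sourceComponent_nonempty hφ j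
    have hx' : x ∈ sourceComponent φ j' := h ▸ hx
    simpa using φ.injective ((hx 0).symm.trans (hx' 0))
  rw [minimalComponents_eq_range hφ hM hi, ← Set.image_univ, hinj.encard_image, Set.encard_univ]
  simp

theorem not_isSimple_of_source (hφ : ∀ v w, D.inc (φ v) (φ w) = sourceBlock i M v w)
    (hM : ∀ v w, 4 ≤ M v w) (hi : 1 ≤ i) (hm : 0 < m) : ¬ D.IsSimple := by
  intro h
  have h1 : sourceComponent φ ⟨0, hi⟩ ∈ D.minimalComponents := by
    rw [minimalComponents_eq_range hφ hM hi]; exact ⟨_, rfl⟩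
  rw [h.minimalComponents_eq, Set.mem_singleton_iff] at h1
  obtain ⟨x, hx⟩ := exists_vertex_eq 0 (φ (.inr ⟨0, hm⟩))
  have h2 : x ∈ sourceComponent φ ⟨0, hi⟩ := h1 ▸ Set.mem_univ x
  exact absurd (φ.injective (hx.symm.trans (h2 0))) (by simp)

end Vertices

/-! ### The measure on the diagram with sources -/

section SourceMeasure

variable {φ : Fin i ⊕ Fin m ≃ Fin D.size} {q : ℕ → Fin m → ℝ}

theorem sum_vertex {α : Type*} [AddCommMonoid α] (φ : Fin i ⊕ Fin m ≃ Fin D.size)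
    (f : Fin D.size → α) : ∑ v, f v = ∑ j, f (φ (.inl j)) + ∑ e, f (φ (.inr e)) := by
  rw [← Equiv.sum_comp φ, Fintype.sum_sum_type]

/-- The masses at the vertices: a source is as heavy as the whole block. -/
def sourceMass (φ : Fin i ⊕ Fin m ≃ Fin D.size) (q : ℕ → Fin m → ℝ) (n : ℕ) (v : Fin D.size) : ℝ :=
  Sum.elim (fun _ => ∑ e, q n e) (q n) (φ.symm v)

@[simp]
theorem sourceMass_inl (n : ℕ) (j : Fin i) : sourceMass φ q n (φ (.inl j)) = ∑ e, q n e := by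
  simp [sourceMass]

@[simp]
theorem sourceMass_inr (n : ℕ) (e : Fin m) : sourceMass φ q n (φ (.inr e)) = q n e := by
  simp [sourceMass]

theorem cast_sum_sub (hM : ∀ v w, 4 ≤ M v w) (e : Fin m) :
    ((∑ w, M e w - 2 : ℕ) : ℝ) = ∑ w, (M e w : ℝ) - 2 := by
  rw [Nat.cast_sub (by have := two_le_sum_sub hM e; omega)]
  simp

theorem sum_inc_inl (hφ : ∀ v w, D.inc (φ v) (φ w) = sourceBlock i M v w)
    (hM : ∀ v w, 4 ≤ M v w) (f : Fin D.size → ℝ) (j : Fin i) :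
    ∑ v, (D.inc v (φ (.inl j)) : ℝ) * f v =
      2 * f (φ (.inl j)) + ∑ e, (∑ w, (M e w : ℝ) - 2) * f (φ (.inr e)) := by
  rw [sum_vertex φ]
  simp only [hφ, sourceBlock, cast_sum_sub hM]
  simp

theorem sum_inc_inr (hφ : ∀ v w, D.inc (φ v) (φ w) = sourceBlock i M v w)
    (f : Fin D.size → ℝ) (e : Fin m) :
    ∑ v, (D.inc v (φ (.inr e)) : ℝ) * f v = ∑ e', (M e' e : ℝ) * f (φ (.inr e')) := by
  rw [sum_vertex φ]
  simp [hφ, sourceBlock]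

theorem isHarmonic_sourceMass (hφ : ∀ v w, D.inc (φ v) (φ w) = sourceBlock i M v w)
    (hM : ∀ v w, 4 ≤ M v w) (h : IsHarmonic M q) : IsHarmonic D.inc (sourceMass φ q) := by
  intro n w
  obtain ⟨w, rfl⟩ := φ.surjective w
  rcases w with j | e
  · rw [sum_inc_inl hφ hM]
    simp only [sourceMass_inl, sourceMass_inr, sub_mul, Finset.sum_sub_distrib, Finset.sum_mul]
    rw [Finset.sum_comm, Finset.mul_sum, add_sub_cancel]
    exact Finset.sum_congr rfl fun w _ => h n w
  · rw [sum_inc_inr hφ, sourceMass_inr]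
    simp only [sourceMass_inr]
    exact h n e

theorem sourceMass_pos (hm : 0 < m) (hq : ∀ n v, 0 < q n v) (n : ℕ) (v : Fin D.size) :
    0 < sourceMass φ q n v := by
  obtain ⟨w, rfl⟩ := φ.surjective v
  rcases w with j | e
  · rw [sourceMass_inl]
    exact Finset.sum_pos (fun e _ => hq n e) ⟨⟨0, hm⟩, Finset.mem_univ _⟩
  · rw [sourceMass_inr]
    exact hq n e

theorem sourceMass_le (hq : ∀ n v, 0 < q n v) (n : ℕ) (v : Fin D.size) :
    sourceMass φ q n v ≤ ∑ e, q n e := by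
  obtain ⟨w, rfl⟩ := φ.surjective v
  rcases w with j | e
  · rw [sourceMass_inl]
  · rw [sourceMass_inr]
    exact Finset.single_le_sum (fun e _ => (hq n e).le) (Finset.mem_univ e)

theorem sum_harmonic_le (h : IsHarmonic M q) (hq : ∀ n v, 0 < q n v) (hM : ∀ v w, 4 ≤ M v w)
    (hm : 0 < m) (n : ℕ) : 4 ^ n * ∑ e, q n e ≤ ∑ e, q 0 e := by
  induction n with
  | zero => simp
  | succ n ih =>
    refine le_trans ?_ ih
    rw [pow_succ, mul_assoc]
    refine mul_le_mul_of_nonneg_left ?_ (by positivity)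
    calc 4 * ∑ e, q (n + 1) e ≤ q n ⟨0, hm⟩ := by
          rw [h n, Finset.mul_sum]
          exact Finset.sum_le_sum fun v _ => mul_le_mul_of_nonneg_right
            (by exact_mod_cast hM v _) (hq _ _).le
      _ ≤ _ := Finset.single_le_sum (fun e _ => (hq n e).le) (Finset.mem_univ _)

/-- The number of sources counted by `c`. -/
def sourceCount (φ : Fin i ⊕ Fin m ≃ Fin D.size) (c : Fin D.size → ℕ) : ℕ := ∑ j, c (φ (.inl j))

/-- The vector on the block of the same mass as `c`: a source is replaced by the whole block. -/
def blockCount (φ : Fin i ⊕ Fin m ≃ Fin D.size) (c : Fin D.size → ℕ) (e : Fin m) : ℕ :=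
  c (φ (.inr e)) + sourceCount φ c

theorem sum_mul_sourceMass (c : Fin D.size → ℕ) (n : ℕ) :
    ∑ v, (c v : ℝ) * sourceMass φ q n v = ∑ e, (blockCount φ c e : ℝ) * q n e := by
  rw [sum_vertex φ]
  simp only [sourceMass_inl, sourceMass_inr, blockCount, sourceCount, Nat.cast_add, Nat.cast_sum,
    add_mul, Finset.sum_add_distrib]
  rw [add_comm, ← Finset.mul_sum, Finset.sum_mul]

theorem sourceCount_mulVec (hφ : ∀ v w, D.inc (φ v) (φ w) = sourceBlock i M v w)
    (c : Fin D.size → ℕ) : sourceCount φ (D.inc.mulVec c) = 2 * sourceCount φ c := by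
  simp only [sourceCount, Matrix.mulVec, dotProduct, Finset.mul_sum]
  refine Finset.sum_congr rfl fun j _ => ?_
  rw [sum_vertex φ]
  simp [hφ, sourceBlock]

theorem blockCount_mulVec (hφ : ∀ v w, D.inc (φ v) (φ w) = sourceBlock i M v w)
    (hM : ∀ v w, 4 ≤ M v w) (c : Fin D.size → ℕ) :
    blockCount φ (D.inc.mulVec c) = M.mulVec (blockCount φ c) := by
  ext e
  have h2 := two_le_sum_sub hM e
  have h3 : D.inc.mulVec c (φ (.inr e)) =
      (∑ w, M e w - 2) * sourceCount φ c + ∑ w, M e w * c (φ (.inr w)) := by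
    rw [Matrix.mulVec, dotProduct, sum_vertex φ]
    simp only [hφ, sourceBlock, sourceCount, Finset.mul_sum]
  rw [blockCount, sourceCount_mulVec hφ, h3, add_right_comm, ← add_mul,
    Nat.sub_add_cancel (by omega), Matrix.mulVec, dotProduct]
  simp only [blockCount, mul_add, Finset.sum_add_distrib, Finset.sum_mul]
  exact add_comm _ _

theorem HasCount.exists_add (hφ : ∀ v w, D.inc (φ v) (φ w) = sourceBlock i M v w)
    (hM : ∀ v w, 4 ≤ M v w) {n : ℕ} {V : Set D.Path} {c : Fin D.size → ℕ} (h : HasCount n V c)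
    (l : ℕ) : ∃ c', HasCount (n + l) V c' ∧ sourceCount φ c' = 2 ^ l * sourceCount φ c ∧
      blockCount φ c' = (M.mulVec)^[l] (blockCount φ c) := by
  induction l with
  | zero => exact ⟨c, h, by simp, rfl⟩
  | succ l ih =>
    obtain ⟨c', h1, h2, h3⟩ := ih
    refine ⟨_, h1.succ, ?_, ?_⟩
    · rw [sourceCount_mulVec hφ, h2, pow_succ']; ring
    · rw [blockCount_mulVec hφ hM, h3, Function.iterate_succ_apply']

theorem cast_iterate_mulVec (M : Matrix (Fin m) (Fin m) ℕ) (a : Fin m → ℕ) (l : ℕ) :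
    (fun e => (((M.mulVec)^[l] a) e : ℝ)) = (pushVec M)^[l] fun e => (a e : ℝ) := by
  induction l with
  | zero => rfl
  | succ l ih =>
    rw [Function.iterate_succ_apply', Function.iterate_succ_apply', ← ih]
    ext e
    simp [pushVec, Matrix.mulVec, dotProduct]

theorem sum_iterate_mulVec (h : IsHarmonic M q) (a : Fin m → ℕ) (n l : ℕ) :
    ∑ e, (((M.mulVec)^[l] a) e : ℝ) * q (n + l) e = ∑ e, (a e : ℝ) * q n e := by
  have := h.sum_mul_iterate n l fun e => (a e : ℝ)
  rw [← cast_iterate_mulVec] at this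
  simpa only [mul_comm] using this

theorem iterate_mulVec_add_pow_le (hM : ∀ v w, 4 ≤ M v w) {a b : Fin m → ℕ}
    (hab : ∀ e, a e + 1 ≤ b e) (l : ℕ) (e : Fin m) :
    ((M.mulVec)^[l] a) e + 4 ^ l ≤ ((M.mulVec)^[l] b) e := by
  induction l generalizing e with
  | zero => simpa using hab e
  | succ l ih =>
    rw [Function.iterate_succ_apply', Function.iterate_succ_apply', Matrix.mulVec, Matrix.mulVec,
      dotProduct, dotProduct]
    calc ∑ w, M e w * ((M.mulVec)^[l] a) w + 4 ^ (l + 1)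
        ≤ ∑ w, M e w * ((M.mulVec)^[l] a) w + ∑ w, M e w * 4 ^ l := by
          refine Nat.add_le_add_left ?_ _
          rw [pow_succ']
          exact (Nat.mul_le_mul_right _ (hM e e)).trans
            (Finset.single_le_sum (f := fun w => M e w * 4 ^ l) (fun _ _ => Nat.zero_le _)
              (Finset.mem_univ e))
      _ = ∑ w, M e w * (((M.mulVec)^[l] a) w + 4 ^ l) := by
          rw [← Finset.sum_add_distrib]
          exact Finset.sum_congr rfl fun w _ => (mul_add _ _ _).symm
      _ ≤ _ := Finset.sum_le_sum fun w _ => Nat.mul_le_mul_left _ (ih w)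

/-- Inside a clopen set there is room for every smaller combination of the masses in the block.
The number of sources in the set only doubles at every level, while the surplus of the block
count grows at least fourfold. -/
theorem exists_isClopen_subset_measureReal
    (hφ : ∀ v w, D.inc (φ v) (φ w) = sourceBlock i M v w) (hM : ∀ v w, 4 ≤ M v w)
    (h : IsHarmonic M q) (hq : ∀ n v, 0 < q n v) {ν : Measure D.Path} [IsProbabilityMeasure ν]
    (hν : ∀ n x, ν.real (cylinder x n) = sourceMass φ q n (vertex x n)) {V : Set D.Path}
    (hV : IsClopen V) (n : ℕ) (a : Fin m → ℕ) (ha : ∑ e, (a e : ℝ) * q n e < ν.real V) :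
    ∃ W : Set D.Path, IsClopen W ∧ W ⊆ V ∧ ν.real W = ∑ e, (a e : ℝ) * q n e := by
  obtain ⟨N, hN⟩ := exists_hasCount hV
  obtain ⟨c, hc⟩ := hN (n + N) (Nat.le_add_left _ _)
  set a₁ := (M.mulVec)^[N] a with ha₁
  have ha₁q : ∑ e, (a₁ e : ℝ) * q (n + N) e = ∑ e, (a e : ℝ) * q n e := sum_iterate_mulVec h a n N
  rw [← ha₁q, hc.measureReal_eq (hν _), sum_mul_sourceMass] at ha
  obtain ⟨l, hl⟩ := h.exists_iterate_pos hq (fun v w => le_trans (by norm_num) (hM v w)) (n + N)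
    (fun e => (blockCount φ c e : ℝ) - a₁ e) (by
      simp only [mul_sub, Finset.sum_sub_distrib]
      simp only [mul_comm (q _ _)]
      linarith)
  have hsub : ∀ l, (pushVec M)^[l] (fun e => (blockCount φ c e : ℝ) - a₁ e) =
      fun e => (((M.mulVec)^[l] (blockCount φ c)) e : ℝ) - ((M.mulVec)^[l] a₁) e := by
    intro l
    induction l with
    | zero => rfl
    | succ l ih =>
      rw [Function.iterate_succ_apply', ih, Function.iterate_succ_apply',
        Function.iterate_succ_apply']
      ext e
      simp [pushVec, Matrix.mulVec, dotProduct, mul_sub, Finset.sum_sub_distrib]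
  rw [hsub] at hl
  have hlt : ∀ e, ((M.mulVec)^[l] a₁) e + 1 ≤ ((M.mulVec)^[l] (blockCount φ c)) e := fun e => by
    have := hl e
    rw [sub_pos] at this
    exact_mod_cast this
  obtain ⟨c₁, hc₁, -, hb₁⟩ := hc.exists_add hφ hM l
  set s := sourceCount φ c₁ with hs
  obtain ⟨c₂, hc₂, hs₂, hb₂⟩ := hc₁.exists_add hφ hM s
  rw [hb₁] at hb₂
  set a₂ := (M.mulVec)^[s] ((M.mulVec)^[l] a₁) with ha₂
  have hle : ∀ e, a₂ e ≤ c₂ (φ (.inr e)) := by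
    intro e
    have h1 := iterate_mulVec_add_pow_le hM hlt s e
    rw [← hb₂, ← ha₂, blockCount, hs₂] at h1
    have h2 : 2 ^ s * s ≤ 4 ^ s := by
      rw [show (4 : ℕ) = 2 * 2 from rfl, mul_pow]
      exact Nat.mul_le_mul_left _ Nat.lt_two_pow_self.le
    rw [← hs] at h1
    omega
  obtain ⟨W, hWV, hW⟩ := hc₂.exists_subset (d := fun v => Sum.elim (fun _ => 0) a₂ (φ.symm v))
    (fun v => by
      obtain ⟨w, rfl⟩ := φ.surjective v
      rcases w with j | e
      · simp
      · simpa using hle e)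
  refine ⟨W, hW.isClopen, hWV, ?_⟩
  rw [hW.measureReal_eq (hν _), sum_vertex φ, ← ha₁q, ← sum_iterate_mulVec h a₁ (n + N) l,
    ← sum_iterate_mulVec h _ (n + N + l) s]
  simp [ha₂]

theorem exists_measureReal_eq_sum {ν : Measure D.Path} [IsProbabilityMeasure ν]
    (hν : ∀ n x, ν.real (cylinder x n) = sourceMass φ q n (vertex x n)) {U : Set D.Path}
    (hU : IsClopen U) : ∃ n, ∃ a : Fin m → ℕ, ν.real U = ∑ e, (a e : ℝ) * q n e := by
  obtain ⟨N, hN⟩ := exists_hasCount hU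
  obtain ⟨c, hc⟩ := hN N le_rfl
  exact ⟨N, blockCount φ c, by rw [hc.measureReal_eq (hν _), sum_mul_sourceMass]⟩

theorem isGoodMeasure_of_source (hφ : ∀ v w, D.inc (φ v) (φ w) = sourceBlock i M v w)
    (hM : ∀ v w, 4 ≤ M v w) (hm : 0 < m) (h : IsHarmonic M q) (hq : ∀ n v, 0 < q n v)
    {ν : Measure D.Path} [IsProbabilityMeasure ν]
    (hν : ∀ n x, ν.real (cylinder x n) = sourceMass φ q n (vertex x n)) : IsGoodMeasure ν where
  full V hV := by
    rintro ⟨x, hx⟩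
    obtain ⟨n, hn⟩ := exists_cylinder_subset (hV.2.mem_nhds hx)
    refine lt_of_lt_of_le ?_ (measure_mono hn)
    have : 0 < ν.real (cylinder x n) := by rw [hν]; exact sourceMass_pos hm hq n _
    exact (ENNReal.toReal_pos_iff.1 this).1
  noAtoms x := by
    have hle : ∀ n, ν.real {x} ≤ (∑ e, q 0 e) * (1 / 4 : ℝ) ^ n := by
      intro n
      have h1 : ν.real {x} ≤ ν.real (cylinder x n) :=
        measureReal_mono (Set.singleton_subset_iff.2 (mem_cylinder_self x n))
      rw [hν] at h1
      have h2 := h1.trans (sourceMass_le hq n _)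
      have h3 := sum_harmonic_le h hq hM hm n
      rw [one_div, inv_pow, ← div_eq_mul_inv, le_div_iff₀ (by positivity), mul_comm]
      exact (mul_le_mul_of_nonneg_left h2 (by positivity)).trans h3
    have hlim : Filter.Tendsto (fun n => (∑ e, q 0 e) * (1 / 4 : ℝ) ^ n) Filter.atTop
        (𝓝 ((∑ e, q 0 e) * 0)) :=
      (tendsto_pow_atTop_nhds_zero_of_lt_one (by norm_num) (by norm_num)).const_mul _
    rw [mul_zero] at hlim
    have h0 : ν.real {x} = 0 := le_antisymm (ge_of_tendsto' hlim hle) measureReal_nonneg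
    exact (measureReal_eq_zero_iff (measure_ne_top _ _)).1 h0
  good V hV U hU hlt := by
    obtain ⟨n, a, ha⟩ := exists_measureReal_eq_sum hν hU
    have hlt' : ν.real U < ν.real V :=
      (ENNReal.toReal_lt_toReal (measure_ne_top _ _) (measure_ne_top _ _)).2 hlt
    obtain ⟨W, hW, hWV, hWm⟩ :=
      exists_isClopen_subset_measureReal hφ hM h hq hν hV n a (ha ▸ hlt')
    refine ⟨W, hW, hWV, ?_⟩
    rw [← ENNReal.toReal_eq_toReal_iff' (measure_ne_top _ _) (measure_ne_top _ _)]
    exact hWm.trans ha.symm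

theorem exists_isClopen_measureReal_iff (hφ : ∀ v w, D.inc (φ v) (φ w) = sourceBlock i M v w)
    (hM : ∀ v w, 4 ≤ M v w) (h : IsHarmonic M q) (hq : ∀ n v, 0 < q n v)
    {ν : Measure D.Path} [IsProbabilityMeasure ν]
    (hν : ∀ n x, ν.real (cylinder x n) = sourceMass φ q n (vertex x n)) (g : ℝ) :
    (∃ V : Set D.Path, IsClopen V ∧ ν.real V = g) ↔ 0 ≤ g ∧ g ≤ 1 ∧ g ∈ h.valueGroup := by
  constructor
  · rintro ⟨V, hV, rfl⟩
    obtain ⟨n, a, ha⟩ := exists_measureReal_eq_sum hν hV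
    exact ⟨measureReal_nonneg, measureReal_le_one, n, fun e => a e, by simpa using ha⟩
  · rintro ⟨hg0, hg1, hg⟩
    rcases hg0.eq_or_lt with rfl | hg0
    · exact ⟨∅, isClopen_empty, by simp⟩
    rcases hg1.eq_or_lt with rfl | hg1
    · exact ⟨Set.univ, isClopen_univ, by simp⟩
    obtain ⟨n, a, -, rfl⟩ :=
      h.exists_nat_rep hq (fun v w => le_trans (by norm_num) (hM v w)) hg hg0
    obtain ⟨W, hW, -, hWm⟩ := exists_isClopen_subset_measureReal hφ hM h hq hν isClopen_univ n a
      (by rwa [probReal_univ])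
    exact ⟨W, hW, hWm⟩

/-- Ergodicity. The restriction of `ν` to a saturated set is invariant; its masses in the block
are proportional to those of `ν` by uniqueness of harmonic sequences, and then the masses of the
sources differ by a sequence that is halved at every level, while the masses of `ν` decay faster. -/
theorem isErgodic_of_source (hφ : ∀ v w, D.inc (φ v) (φ w) = sourceBlock i M v w)
    (hM : ∀ v w, 4 ≤ M v w) (hm : 0 < m) (h : IsHarmonic M q) (hq : ∀ n v, 0 < q n v)
    {ν : Measure D.Path} [IsProbabilityMeasure ν] (hinv : IsInvariant ν)
    (hν : ∀ n x, ν.real (cylinder x n) = sourceMass φ q n (vertex x n)) : IsErgodic ν := by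
  intro A hA hsat
  have hcm : ∀ (x : D.Path) n, MeasurableSet (cylinder x n) :=
    fun x n => (isClopen_cylinder x n).2.measurableSet
  have hinvA : IsInvariant (ν.restrict A) := by
    intro n x y hxy
    rw [Measure.restrict_apply (hcm x n), Measure.restrict_apply (hcm y n), Set.inter_comm,
      Set.inter_comm _ A]
    exact hinv.measure_inter_cylinder hA hsat hxy
  set f := mass (ν.restrict A) with hf
  have hfc : ∀ n x, (ν.restrict A).real (cylinder x n) = f n (vertex x n) :=
    fun n x => hinvA.measureReal_cylinder x n
  have hfh : IsHarmonic D.inc f := isHarmonic_of_cylinder hfc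
  have hph := isHarmonic_sourceMass hφ hM h
  have hfp : ∀ n v, f n v ≤ sourceMass φ q n v := by
    intro n v
    obtain ⟨x, rfl⟩ := exists_vertex_eq n v
    rw [← hfc, ← hν]
    exact ENNReal.toReal_mono (measure_ne_top _ _) (Measure.restrict_le_self _)
  have : Nonempty (Fin m) := ⟨⟨0, hm⟩⟩
  obtain ⟨c, hc⟩ := h.eq_smul (f := fun n e => f n (φ (.inr e))) hq
    (fun v w => le_trans (by norm_num) (hM v w))
    (fun n e => (hfh n _).trans (sum_inc_inr hφ (f (n + 1)) e)) (fun n e => mass_nonneg _ _ _)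
  have hc0 : 0 ≤ c := by
    have h1 := hc 0 ⟨0, hm⟩
    have h2 : 0 ≤ f 0 (φ (.inr ⟨0, hm⟩)) := mass_nonneg _ _ _
    rw [show f 0 (φ (.inr ⟨0, hm⟩)) = c * q 0 ⟨0, hm⟩ from h1] at h2
    exact nonneg_of_mul_nonneg_left h2 (hq _ _)
  -- the defect at a source is halved at every level
  have hdef : ∀ j n k, f n (φ (.inl j)) - c * sourceMass φ q n (φ (.inl j)) =
      2 ^ k * (f (n + k) (φ (.inl j)) - c * sourceMass φ q (n + k) (φ (.inl j))) := by
    intro j n k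
    induction k with
    | zero => simp
    | succ k ih =>
      rw [ih, hfh (n + k), hph (n + k), sum_inc_inl hφ hM, sum_inc_inl hφ hM]
      simp only [sourceMass_inr, show ∀ n e, f n (φ (.inr e)) = c * q n e from hc]
      have : ∑ e, (∑ w, (M e w : ℝ) - 2) * (c * q (n + k + 1) e) =
          c * ∑ e, (∑ w, (M e w : ℝ) - 2) * q (n + k + 1) e := by
        rw [Finset.mul_sum]
        exact Finset.sum_congr rfl fun e _ => by ring
      rw [this, ← add_assoc]
      ring
  have hsrc : ∀ j n, f n (φ (.inl j)) = c * sourceMass φ q n (φ (.inl j)) := by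
    intro j n
    set S := ∑ e, q 0 e with hS
    have hbound : ∀ k, |f n (φ (.inl j)) - c * sourceMass φ q n (φ (.inl j))| ≤
        ((1 + c) * S) * (1 / 2 : ℝ) ^ k := by
      intro k
      rw [hdef j n k, abs_mul, abs_of_pos (by positivity : (0 : ℝ) < 2 ^ k)]
      have h1 : |f (n + k) (φ (.inl j)) - c * sourceMass φ q (n + k) (φ (.inl j))| ≤
          (1 + c) * ∑ e, q (n + k) e := by
        have h2 := hfp (n + k) (φ (.inl j))
        have h3 : 0 ≤ f (n + k) (φ (.inl j)) := mass_nonneg _ _ _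
        rw [sourceMass_inl] at h2 ⊢
        have h4 : 0 ≤ c * ∑ e, q (n + k) e := mul_nonneg hc0 (h3.trans h2)
        rw [abs_le]
        constructor <;> nlinarith
      have h5 := sum_harmonic_le h hq hM hm (n + k)
      have h6 : (4 : ℝ) ^ k * ∑ e, q (n + k) e ≤ S := by
        refine le_trans (mul_le_mul_of_nonneg_right (pow_le_pow_right₀ (by norm_num) ?_) ?_) h5
        · omega
        · exact Finset.sum_nonneg fun e _ => (hq _ e).le
      have h7 : (2 : ℝ) ^ k * ∑ e, q (n + k) e ≤ S * (1 / 2) ^ k := by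
        rw [one_div, inv_pow, ← div_eq_mul_inv, le_div_iff₀ (by positivity)]
        calc (2 : ℝ) ^ k * (∑ e, q (n + k) e) * 2 ^ k = (2 * 2) ^ k * ∑ e, q (n + k) e := by
              rw [mul_pow]; ring
          _ ≤ S := by norm_num; exact h6
      calc 2 ^ k * |f (n + k) (φ (.inl j)) - c * sourceMass φ q (n + k) (φ (.inl j))|
          ≤ 2 ^ k * ((1 + c) * ∑ e, q (n + k) e) := mul_le_mul_of_nonneg_left h1 (by positivity)
        _ = (1 + c) * (2 ^ k * ∑ e, q (n + k) e) := by ring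
        _ ≤ (1 + c) * (S * (1 / 2) ^ k) := mul_le_mul_of_nonneg_left h7 (by linarith)
        _ = _ := by ring
    have hlim : Filter.Tendsto (fun k => ((1 + c) * S) * (1 / 2 : ℝ) ^ k) Filter.atTop
        (𝓝 (((1 + c) * S) * 0)) :=
      (tendsto_pow_atTop_nhds_zero_of_lt_one (by norm_num) (by norm_num)).const_mul _
    rw [mul_zero] at hlim
    have := le_antisymm (ge_of_tendsto' hlim hbound) (abs_nonneg _)
    linarith [abs_eq_zero.1 this]
  have hall : ∀ n v, f n v = c * sourceMass φ q n v := by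
    intro n v
    obtain ⟨w, rfl⟩ := φ.surjective v
    rcases w with j | e
    · exact hsrc j n
    · rw [sourceMass_inr]; exact hc n e
  have hmeas : ν.restrict A = c.toNNReal • ν := by
    refine measure_ext_of_cylinder 0 fun n _ x => ?_
    rw [← ENNReal.toReal_eq_toReal_iff' (measure_ne_top _ _) (measure_ne_top _ _)]
    have h1 := (hfc n x).trans ((hall n _).trans (by rw [← hν]))
    change (ν.restrict A).real (cylinder x n) = _
    rw [h1, Measure.smul_apply, ENNReal.smul_def, smul_eq_mul, ENNReal.toReal_mul,
      ENNReal.coe_toReal, Real.coe_toNNReal _ hc0]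
    rfl
  have h1 := congrArg (fun m => m Aᶜ) hmeas
  have h2 := congrArg (fun m => m A) hmeas
  simp only [Measure.restrict_apply hA.compl, Measure.restrict_apply hA, Set.compl_inter_self,
    Set.inter_self, measure_empty, Measure.smul_apply, ENNReal.smul_def, smul_eq_mul] at h1 h2
  rcases mul_eq_zero.1 h1.symm with h0 | h0
  · left
    rw [h2, h0, zero_mul]
  · right
    exact (prob_compl_eq_zero_iff hA).1 h0

end SourceMeasure

end StationaryBratteli

/-! ### The family of diagrams -/

section Shift

variable {E : Type*} [Fintype E] {M : Matrix E E ℕ} {q : ℕ → E → ℝ}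

theorem IsHarmonic.shift (h : IsHarmonic M q) (N : ℕ) : IsHarmonic M fun n => q (N + n) :=
  fun n w => h (N + n) w

theorem IsHarmonic.valueGroup_shift (h : IsHarmonic M q) (N : ℕ) :
    (h.shift N).valueGroup = h.valueGroup := by
  ext g
  constructor
  · rintro ⟨n, a, ha⟩
    exact ⟨N + n, a, ha⟩
  · rintro ⟨n, a, rfl⟩
    obtain ⟨b, hb⟩ := h.exists_int_rep (Nat.le_add_left n N) a
    exact ⟨n, b, hb.symm⟩

end Shift

namespace StationaryBratteli

variable {m : ℕ} {M : Matrix (Fin m) (Fin m) ℕ}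

/-- The stationary diagram with `i` sources above the block `M`, and with `t e` edges from the
vertex of level `0` to the vertex `e` of the block and one edge to every source. -/
def sourceDiagram (i : ℕ) (M : Matrix (Fin m) (Fin m) ℕ) (t : Fin m → ℕ) (hm : 0 < m)
    (hM : ∀ v w, 4 ≤ M v w) (ht : ∀ e, 0 < t e) : StationaryBratteli where
  size := i + m
  top v := Sum.elim (fun _ => 1) t (finSumFinEquiv.symm v)
  inc := Matrix.of fun v w => sourceBlock i M (finSumFinEquiv.symm v) (finSumFinEquiv.symm w)
  size_pos := by omega
  top_pos v := by
    rcases finSumFinEquiv.symm v with j | e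
    · exact one_pos
    · exact ht e
  exists_in v := by
    obtain ⟨w, rfl⟩ := finSumFinEquiv.surjective v
    refine ⟨finSumFinEquiv w, ?_⟩
    rcases w with j | e
    · simp [sourceBlock]
    · simpa [sourceBlock] using lt_of_lt_of_le four_pos (hM e e)
  exists_out v := by
    refine ⟨finSumFinEquiv (.inr ⟨0, hm⟩), ?_⟩
    rw [Matrix.of_apply, Equiv.symm_apply_apply]
    rcases finSumFinEquiv.symm v with j | e
    · exact lt_of_lt_of_le two_pos (two_le_sum_sub hM ⟨0, hm⟩)
    · exact lt_of_lt_of_le four_pos (hM ⟨0, hm⟩ e)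

/-- For every number `i` of sources there is a diagram whose path space carries a good ergodic
measure with the clopen values prescribed by the value group. -/
theorem exists_source_diagram {q : ℕ → Fin m → ℝ} (h : IsHarmonic M q) (hm : 0 < m)
    (hM : ∀ v w, 4 ≤ M v w) (hq : ∀ n v, 0 < q n v) (h1 : (1 : ℝ) ∈ h.valueGroup) (i : ℕ) :
    ∃ (D : StationaryBratteli) (ν : Measure D.Path) (φ : Fin i ⊕ Fin m ≃ Fin D.size),
      (∀ v w, D.inc (φ v) (φ w) = sourceBlock i M v w) ∧ IsProbabilityMeasure ν ∧
      IsInvariant ν ∧ IsErgodic ν ∧ IsGoodMeasure ν ∧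
      ∀ g : ℝ, (∃ V : Set D.Path, IsClopen V ∧ ν.real V = g) ↔
        0 ≤ g ∧ g ≤ 1 ∧ g ∈ h.valueGroup := by
  obtain ⟨n, a, ha0, ha⟩ :=
    h.exists_nat_rep hq (fun v w => le_trans (by norm_num) (hM v w)) h1 one_pos
  -- after `i` more levels the coefficients of the unit exceed `i`
  set b := (M.mulVec)^[i] a with hb
  have hbi : ∀ e, i < b e := by
    intro e
    have := iterate_mulVec_add_pow_le hM (a := 0) (b := a)
      (fun e => by simpa using Nat.succ_le_of_lt (ha0 e)) i e
    rw [← hb] at this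
    have h4 : i < 4 ^ i := Nat.lt_pow_self (by norm_num)
    omega
  have hb1 : ∑ e, (b e : ℝ) * q (n + i) e = 1 := (sum_iterate_mulVec h a n i).trans ha.symm
  have h' := h.shift (n + i)
  have hq' : ∀ k e, 0 < q (n + i + k) e := fun k e => hq _ _
  let D := sourceDiagram i M (fun e => b e - i) hm hM fun e => Nat.sub_pos_of_lt (hbi e)
  let φ : Fin i ⊕ Fin m ≃ Fin D.size := finSumFinEquiv
  have hφ : ∀ v w, D.inc (φ v) (φ w) = sourceBlock i M v w := fun v w => by
    change sourceBlock i M (finSumFinEquiv.symm (finSumFinEquiv v))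
      (finSumFinEquiv.symm (finSumFinEquiv w)) = _
    rw [Equiv.symm_apply_apply, Equiv.symm_apply_apply]
  have htop : ∑ v, (D.top v : ℝ) * sourceMass φ (fun k => q (n + i + k)) 0 v = 1 := by
    have e0 : ∀ v, D.top (φ v) = Sum.elim (fun _ => 1) (fun e => b e - i) v := fun v => by
      change Sum.elim _ _ (finSumFinEquiv.symm (finSumFinEquiv v)) = _
      rw [Equiv.symm_apply_apply]
    have e1 : ∀ j, D.top (φ (.inl j)) = 1 := fun j => e0 _
    have e2 : ∀ e, D.top (φ (.inr e)) = b e - i := fun e => e0 _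
    rw [sum_vertex φ]
    simp only [sourceMass_inl, sourceMass_inr, e1, e2, Nat.cast_sub (hbi _).le, sub_mul,
      Finset.sum_sub_distrib, add_zero, hb1, ← Finset.mul_sum]
    simp
  obtain ⟨ν, hprob, hν⟩ := exists_measure_of_isHarmonic (sourceMass_pos hm hq')
    (isHarmonic_sourceMass hφ hM h') htop
  have hinv : IsInvariant ν := fun k x y hxy => by
    rw [← ENNReal.toReal_eq_toReal_iff' (measure_ne_top _ _) (measure_ne_top _ _)]
    exact (hν k x).trans ((congrArg _ hxy).trans (hν k y).symm)
  refine ⟨D, ν, φ, hφ, hprob, hinv, isErgodic_of_source hφ hM hm h' hq' hinv hν,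
    isGoodMeasure_of_source hφ hM hm h' hq' hν, fun g => ?_⟩
  rw [← h.valueGroup_shift (n + i)]
  exact exists_isClopen_measureReal_iff hφ hM h' hq' hν g

end StationaryBratteli

theorem mainTheorem3 (B : StationaryBratteli) (hB : B.IsCantor)
    (μ : Measure B.Path) (hprob : IsProbabilityMeasure μ)
    (hinv : StationaryBratteli.IsInvariant μ) (herg : StationaryBratteli.IsErgodic μ)
    (hgood : IsGoodMeasure (suppMeasure μ)) :
    ∃ (D : ℕ → StationaryBratteli) (ν : ∀ i : ℕ, Measure (D i).Path),
      (∀ i : ℕ,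
        (D i).IsCantor ∧ (D i).IsAperiodic ∧
        IsProbabilityMeasure (ν i) ∧
        StationaryBratteli.IsInvariant (ν i) ∧
        StationaryBratteli.IsErgodic (ν i) ∧
        IsGoodMeasure (ν i) ∧
        HomeomorphicMeasures (suppMeasure μ) (ν i)) ∧
      (∀ i j : ℕ, StationaryBratteli.OrbitEquivalent (D i) (D j) ↔ i = j) ∧
      (D 0).IsSimple ∧
      (∀ i : ℕ, 1 ≤ i → (D i).minimalComponents.encard = (i : ℕ∞)) := by
  obtain ⟨m, M, q, h, hm, hM, hq, hval⟩ := StationaryBratteli.exists_block_of_good hinv herg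
    hgood.measure_singleton_eq_zero fun V hV => hgood.isGoodClopen_of_suppMeasure hV
  have h1 : (1 : ℝ) ∈ h.valueGroup :=
    ((hval 1).1 ⟨Set.univ, isClopen_univ, probReal_univ⟩).2.2
  choose D ν φ hφ hν hνinv hνerg hνgood hνval using
    StationaryBratteli.exists_source_diagram h hm hM hq h1
  have hsupp := isProbabilityMeasure_suppMeasure μ
  have : CompactSpace μ.support :=
    isCompact_iff_compactSpace.1 Measure.isClosed_support.isCompact
  have hsimple : (D 0).IsSimple := by
    refine StationaryBratteli.isSimple_of_inc_pos fun v w => ?_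
    obtain ⟨v, rfl⟩ := (φ 0).surjective v
    obtain ⟨w, rfl⟩ := (φ 0).surjective w
    rw [hφ]
    rcases v with j | e
    · exact j.elim0
    · rcases w with j | e'
      · exact j.elim0
      · exact lt_of_lt_of_le (by norm_num) (hM e e')
  have hcomp : ∀ i, 1 ≤ i → (D i).minimalComponents.encard = i := fun i hi =>
    StationaryBratteli.encard_minimalComponents (hφ i) hM hi
  -- an orbit equivalence with the simple diagram forces simplicity
  have hzero : ∀ j, StationaryBratteli.OrbitEquivalent (D 0) (D j) → j = 0 := fun j hj => by
    by_contra hj0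
    exact StationaryBratteli.not_isSimple_of_source (hφ j) hM (Nat.pos_of_ne_zero hj0) hm
      (hj.isSimple hsimple)
  refine ⟨D, ν, fun i => ⟨?_, ?_, hν i, hνinv i, hνerg i, hνgood i, ?_⟩,
    fun i j => ⟨fun hij => ?_, ?_⟩, hsimple, hcomp⟩
  · exact StationaryBratteli.isCantor_of_two_le (StationaryBratteli.two_le_inc_of_pos (hφ i) hM)
  · exact StationaryBratteli.isAperiodic_of_two_le (StationaryBratteli.two_le_inc_of_pos (hφ i) hM)
  · have := hν i
    refine homeomorphicMeasures_of_clopen_values hgood (hνgood i) (fun U hU => ?_) fun V hV => ?_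
    · obtain ⟨V, hV, rfl⟩ := exists_isClopen_preimage_support μ hU
      obtain ⟨W, hW, hWV⟩ := (hνval i _).2 ((hval _).1 ⟨V, hV, rfl⟩)
      refine ⟨W, hW, ?_⟩
      rw [suppMeasure_preimage]
      exact (ENNReal.toReal_eq_toReal_iff' (measure_ne_top _ _) (measure_ne_top _ _)).1 hWV
    · obtain ⟨U, hU, hUV⟩ := (hval _).2 ((hνval i _).1 ⟨V, hV, rfl⟩)
      refine ⟨_, hU.preimage continuous_subtype_val, ?_⟩
      rw [suppMeasure_preimage]
      exact (ENNReal.toReal_eq_toReal_iff' (measure_ne_top _ _) (measure_ne_top _ _)).1 hUV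
  · rcases Nat.eq_zero_or_pos i with rfl | hi
    · exact (hzero j hij).symm
    rcases Nat.eq_zero_or_pos j with rfl | hj
    · exact hzero i hij.symm
    have := le_antisymm hij.encard_minimalComponents_le hij.symm.encard_minimalComponents_le
    rw [hcomp i hi, hcomp j hj] at this
    exact_mod_cast this
  · rintro rfl
    exact ⟨Homeomorph.refl _, fun x y => Iff.rfl⟩
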